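/- Let $G$ be a finite group of order $e$, and let $\mathcal L_G$ be the language of rings $\{+,\cdot,0,1\}$ together with a unary function symbol $\sigma_g$ for every $g\in G$. A $G$-transformal field is an $\mathcal L_G$-structure $K$ which is a field and on which $g\mapsto\sigma_g$ is a group homomorphism $G\to\operatorname{Aut}(K)$ (not necessarily injective). For $n\geq 1$ consider the polynomial ring $K[X_{h,i} : h\in G,\ 1\le i\le n]$, and let $g\in G$ act on it by applying $\sigma_g$ to the coefficients and sending $X_{h,i}$ to $X_{gh,i}$. An ideal $I$ of this ring is called $G$-invariant if $g(I)\subseteq I$ for all $g\in G$. For an ideal $I$ let $V_K(I)\subseteq K^{ne}$ be its set of $K$-rational zeros, and for $a\in K^n$ put $\bar\sigma(a)=(\sigma_h(a_i))_{h\in G,\,1\le i\le n}\in K^{ne}$. A $G$-transformal field $K$ is said to satisfy $(\clubsuit)$ if for every $n\ge 1$ and all ideals $I\subsetneq J$ of $K[X_{h,i}]$ such that $I$ is prime and $G$-invariant, there is $a\in K^n$ with $\bar\sigma(a)\in V_K(I)\setminus V_K(J)$. Theorem. 1. $(\clubsuit)$ is first order: there is an $\mathcal L_G$-theory, $G$-TCF,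 whose models are exactly the $G$-transformal fields satisfying $(\clubsuit)$. 2. Every $G$-transformal field embeds (as an $\mathcal L_G$-structure) in a $G$-transformal field satisfying $(\clubsuit)$. 3. Every model $K$ of $G$-TCF is an existentially closed $G$-transformal field: every quantifier-free $\mathcal L_G$-formula with parameters in $K$ which has a solution in some $G$-transformal field extending $K$ has a solution in $K$. 4. $G$-TCF is model complete, that is, every embedding between models of $G$-TCF is elementary. 5. Consequently $G$-TCF is a model companion of the theory of $G$-transformal fields: it is model complete, every $G$-transformal field embeds in a model of $G$-TCF, and every model of $G$-TCF embeds in a $G$-transformal field. -/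

import Mathlib

open scoped FirstOrder

universe u v

namespace GTransformal

/-! ### General model theory -/

section ModelTheory

variable {L : FirstOrder.Language}

/-- `T` is model complete: every embedding between models of `T` is elementary. -/
def IsModelComplete (T : L.Theory) : Prop :=
  ∀ (M N : Type u) [L.Structure M] [L.Structure N], M ⊨ T → N ⊨ T →
    ∀ (f : M ↪[L] N) (n : ℕ) (φ : L.Formula (Fin n)) (x : Fin n → M),
      φ.Realize (f ∘ x) ↔ φ.Realize x

/-- Every model of `T` embeds in a model of `T'`. -/
def ModelsEmbedIn (T T' : L.Theory) : Prop :=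
  ∀ (M : Type u) [L.Structure M], M ⊨ T →
    ∃ (N : Type u) (_ : L.Structure N), N ⊨ T' ∧ Nonempty (M ↪[L] N)

/-- `T'` is a model companion of `T`: it is model complete, every model of `T` embeds in a model
of `T'`, and every model of `T'` embeds in a model of `T`. -/
def IsModelCompanion (T' T : L.Theory) : Prop :=
  IsModelComplete.{u} T' ∧ ModelsEmbedIn.{u} T T' ∧ ModelsEmbedIn.{u} T' T

/-- `M` is an existentially closed model of `T`: it is a model of `T`, and every quantifier-free
formula with parameters from `M` that has a solution in some model of `T` extending `M` already has
a solution in `M`. The variables `Sum.inl i` hold the parameters `c i`. -/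
def IsExistentiallyClosed (T : L.Theory) (M : Type u) [L.Structure M] : Prop :=
  M ⊨ T ∧ ∀ (N : Type u) [L.Structure N], N ⊨ T → ∀ (f : M ↪[L] N) (m k : ℕ)
    (φ : L.Formula (Fin m ⊕ Fin k)), φ.IsQF → ∀ c : Fin m → M,
      (∃ b : Fin k → N, φ.Realize (Sum.elim (f ∘ c) b)) →
        ∃ b : Fin k → M, φ.Realize (Sum.elim c b)

end ModelTheory

/-! ### The language and the theory of `G`-transformal fields -/

/-- The function symbols `+`, `·`, `0`, `1`, and a unary `σ_g` for each `g : G`. -/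
inductive Func (G : Type v) : ℕ → Type v
  | add : Func G 2
  | mul : Func G 2
  | zero : Func G 0
  | one : Func G 0
  | sigma (g : G) : Func G 1

/-- The language of rings with unary function symbols `σ_g`, `g : G`. -/
def lang (G : Type v) : FirstOrder.Language.{v, 0} where
  Functions := Func G
  Relations := fun _ => Empty

section Terms

variable {G : Type v}

abbrev addF : (lang G).Functions 2 := Func.add

abbrev mulF : (lang G).Functions 2 := Func.mul

abbrev zeroF : (lang G).Functions 0 := Func.zero

abbrev oneF : (lang G).Functions 0 := Func.one

abbrev sigmaF (g : G) : (lang G).Functions 1 := Func.sigma g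

variable {α : Type}

def tAdd (s t : (lang G).Term α) : (lang G).Term α := addF.apply₂ s t

def tMul (s t : (lang G).Term α) : (lang G).Term α := mulF.apply₂ s t

def tZero : (lang G).Term α := .func zeroF ![]

def tOne : (lang G).Term α := .func oneF ![]

def tSigma (g : G) (t : (lang G).Term α) : (lang G).Term α := (sigmaF g).apply₁ t

open FirstOrder.Language

variable {K : Type u} [(lang G).Structure K] (w : α → K)

theorem realize_tAdd (s t : (lang G).Term α) :
    (tAdd s t).realize w = Structure.funMap (addF (G := G)) ![s.realize w, t.realize w] :=
  Term.realize_functions_apply₂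

theorem realize_tMul (s t : (lang G).Term α) :
    (tMul s t).realize w = Structure.funMap (mulF (G := G)) ![s.realize w, t.realize w] :=
  Term.realize_functions_apply₂

theorem realize_tZero :
    (tZero : (lang G).Term α).realize w = Structure.funMap (zeroF (G := G)) ![] := by
  rw [tZero, Term.realize]
  exact congrArg _ (Subsingleton.elim _ _)

theorem realize_tOne :
    (tOne : (lang G).Term α).realize w = Structure.funMap (oneF (G := G)) ![] := by
  rw [tOne, Term.realize]
  exact congrArg _ (Subsingleton.elim _ _)

theorem realize_tSigma (g : G) (t : (lang G).Term α) :
    (tSigma g t).realize w = Structure.funMap (sigmaF g) ![t.realize w] :=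
  Term.realize_functions_apply₁

end Terms

section Theory

variable (G : Type v) [Group G]

/-- Names of the axioms of `G`-transformal fields. -/
inductive FieldAx : Type v
  | addAssoc | addComm | zeroAdd | existsNeg
  | mulAssoc | mulComm | oneMul | existsInv | leftDistrib | zeroNeOne
  | sigmaAdd (g : G) | sigmaMul (g : G) | sigmaOne (g : G)
  | sigmaId | sigmaComp (g h : G)

variable {G}

/-- The axioms of `G`-transformal fields: the field axioms, each `σ_g` is a ring endomorphism,
`σ_1 = id` and `σ_g ∘ σ_h = σ_{gh}`. -/
def FieldAx.toSentence : FieldAx G → (lang G).Sentence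
  | .addAssoc => ∀' ∀' ∀' (tAdd (tAdd (&0) (&1)) (&2) =' tAdd (&0) (tAdd (&1) (&2)))
  | .addComm => ∀' ∀' (tAdd (&0) (&1) =' tAdd (&1) (&0))
  | .zeroAdd => ∀' (tAdd tZero (&0) =' &0)
  | .existsNeg => ∀' ∃' (tAdd (&0) (&1) =' tZero)
  | .mulAssoc => ∀' ∀' ∀' (tMul (tMul (&0) (&1)) (&2) =' tMul (&0) (tMul (&1) (&2)))
  | .mulComm => ∀' ∀' (tMul (&0) (&1) =' tMul (&1) (&0))
  | .oneMul => ∀' (tMul tOne (&0) =' &0)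
  | .existsInv => ∀' (∼(&0 =' tZero) ⟹ ∃' (tMul (&0) (&1) =' tOne))
  | .leftDistrib =>
      ∀' ∀' ∀' (tMul (&0) (tAdd (&1) (&2)) =' tAdd (tMul (&0) (&1)) (tMul (&0) (&2)))
  | .zeroNeOne => ∼(tZero =' tOne)
  | .sigmaAdd g =>
      ∀' ∀' (tSigma g (tAdd (&0) (&1)) =' tAdd (tSigma g (&0)) (tSigma g (&1)))
  | .sigmaMul g =>
      ∀' ∀' (tSigma g (tMul (&0) (&1)) =' tMul (tSigma g (&0)) (tSigma g (&1)))
  | .sigmaOne g => tSigma g tOne =' tOne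
  | .sigmaId => ∀' (tSigma 1 (&0) =' &0)
  | .sigmaComp g h => ∀' (tSigma g (tSigma h (&0)) =' tSigma (g * h) (&0))

variable (G)

/-- The first-order theory of `G`-transformal fields. -/
def fieldTheory : (lang G).Theory :=
  Set.range (FieldAx.toSentence (G := G))

end Theory

section Structures

variable (G : Type v) [Group G]

/-- The `lang G`-structure of a field `K` on which `G` acts by field automorphisms. -/
@[reducible]
def toStructure (K : Type u) [Field K] [MulSemiringAction G K] : (lang G).Structure K where
  funMap := fun {n} f =>
    match n, f with
    | _, Func.add => fun x => x 0 + x 1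
    | _, Func.mul => fun x => x 0 * x 1
    | _, Func.zero => fun _ => 0
    | _, Func.one => fun _ => 1
    | _, Func.sigma g => fun x => g • x 0
  RelMap := fun r => Empty.elim r

/-- A `lang G`-structure is a `G`-transformal field if it comes from a field with an action of `G`
by field automorphisms, that is, with a group homomorphism from `G` to the automorphism group. -/
def IsTransformalField (K : Type u) [S : (lang G).Structure K] : Prop :=
  ∃ (_ : Field K) (_ : MulSemiringAction G K), S = toStructure G K

/-- The models of `fieldTheory G` are exactly the `G`-transformal fields. -/
theorem model_fieldTheory_iff (K : Type u) [S : (lang G).Structure K] :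
    K ⊨ fieldTheory G ↔ IsTransformalField G K := by
  classical
  constructor
  · intro h
    have key : ∀ ax : FieldAx G, K ⊨ ax.toSentence := fun ax =>
      h.realize_of_mem _ (Set.mem_range_self ax)
    let add : K → K → K := fun x y => S.funMap addF ![x, y]
    let mul : K → K → K := fun x y => S.funMap mulF ![x, y]
    let zero : K := S.funMap zeroF ![]
    let one : K := S.funMap oneF ![]
    let sg : G → K → K := fun g x => S.funMap (sigmaF g) ![x]
    have addAssoc : ∀ x y z, add (add x y) z = add x (add y z) := by
      simpa [FieldAx.toSentence, FirstOrder.Language.Sentence.Realize,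
        FirstOrder.Language.Formula.Realize, realize_tAdd, realize_tMul, realize_tZero, realize_tOne,
        realize_tSigma, Fin.snoc] using key .addAssoc
    have addComm : ∀ x y, add x y = add y x := by
      simpa [FieldAx.toSentence, FirstOrder.Language.Sentence.Realize,
        FirstOrder.Language.Formula.Realize, realize_tAdd, realize_tMul, realize_tZero, realize_tOne,
        realize_tSigma, Fin.snoc] using key .addComm
    have zeroAdd : ∀ x, add zero x = x := by
      simpa [FieldAx.toSentence, FirstOrder.Language.Sentence.Realize,
        FirstOrder.Language.Formula.Realize, realize_tAdd, realize_tMul, realize_tZero, realize_tOne,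
        realize_tSigma, Fin.snoc] using key .zeroAdd
    have existsNeg : ∀ x, ∃ y, add x y = zero := by
      simpa [FieldAx.toSentence, FirstOrder.Language.Sentence.Realize,
        FirstOrder.Language.Formula.Realize, realize_tAdd, realize_tMul, realize_tZero, realize_tOne,
        realize_tSigma, Fin.snoc] using key .existsNeg
    have mulAssoc : ∀ x y z, mul (mul x y) z = mul x (mul y z) := by
      simpa [FieldAx.toSentence, FirstOrder.Language.Sentence.Realize,
        FirstOrder.Language.Formula.Realize, realize_tAdd, realize_tMul, realize_tZero, realize_tOne,
        realize_tSigma, Fin.snoc] using key .mulAssoc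
    have mulComm : ∀ x y, mul x y = mul y x := by
      simpa [FieldAx.toSentence, FirstOrder.Language.Sentence.Realize,
        FirstOrder.Language.Formula.Realize, realize_tAdd, realize_tMul, realize_tZero, realize_tOne,
        realize_tSigma, Fin.snoc] using key .mulComm
    have oneMul : ∀ x, mul one x = x := by
      simpa [FieldAx.toSentence, FirstOrder.Language.Sentence.Realize,
        FirstOrder.Language.Formula.Realize, realize_tAdd, realize_tMul, realize_tZero, realize_tOne,
        realize_tSigma, Fin.snoc] using key .oneMul
    have existsInv : ∀ x, x ≠ zero → ∃ y, mul x y = one := by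
      simpa [FieldAx.toSentence, FirstOrder.Language.Sentence.Realize,
        FirstOrder.Language.Formula.Realize, realize_tAdd, realize_tMul, realize_tZero, realize_tOne,
        realize_tSigma, Fin.snoc] using key .existsInv
    have leftDistrib : ∀ x y z, mul x (add y z) = add (mul x y) (mul x z) := by
      simpa [FieldAx.toSentence, FirstOrder.Language.Sentence.Realize,
        FirstOrder.Language.Formula.Realize, realize_tAdd, realize_tMul, realize_tZero, realize_tOne,
        realize_tSigma, Fin.snoc] using key .leftDistrib
    have zeroNeOne : zero ≠ one := by
      simpa [FieldAx.toSentence, FirstOrder.Language.Sentence.Realize,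
        FirstOrder.Language.Formula.Realize, realize_tAdd, realize_tMul, realize_tZero, realize_tOne,
        realize_tSigma, Fin.snoc] using key .zeroNeOne
    have sigmaAdd : ∀ g x y, sg g (add x y) = add (sg g x) (sg g y) := by
      intro g
      simpa [FieldAx.toSentence, FirstOrder.Language.Sentence.Realize,
        FirstOrder.Language.Formula.Realize, realize_tAdd, realize_tMul, realize_tZero, realize_tOne,
        realize_tSigma, Fin.snoc] using key (.sigmaAdd g)
    have sigmaMul : ∀ g x y, sg g (mul x y) = mul (sg g x) (sg g y) := by
      intro g
      simpa [FieldAx.toSentence, FirstOrder.Language.Sentence.Realize,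
        FirstOrder.Language.Formula.Realize, realize_tAdd, realize_tMul, realize_tZero, realize_tOne,
        realize_tSigma, Fin.snoc] using key (.sigmaMul g)
    have sigmaOne : ∀ g, sg g one = one := by
      intro g
      simpa [FieldAx.toSentence, FirstOrder.Language.Sentence.Realize,
        FirstOrder.Language.Formula.Realize, realize_tAdd, realize_tMul, realize_tZero, realize_tOne,
        realize_tSigma, Fin.snoc] using key (.sigmaOne g)
    have sigmaId : ∀ x, sg 1 x = x := by
      simpa [FieldAx.toSentence, FirstOrder.Language.Sentence.Realize,
        FirstOrder.Language.Formula.Realize, realize_tAdd, realize_tMul, realize_tZero, realize_tOne,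
        realize_tSigma, Fin.snoc] using key .sigmaId
    have sigmaComp : ∀ g h x, sg g (sg h x) = sg (g * h) x := by
      intro g h
      simpa [FieldAx.toSentence, FirstOrder.Language.Sentence.Realize,
        FirstOrder.Language.Formula.Realize, realize_tAdd, realize_tMul, realize_tZero, realize_tOne,
        realize_tSigma, Fin.snoc] using key (.sigmaComp g h)
    choose ng hng using existsNeg
    let : Add K := ⟨add⟩
    let : Mul K := ⟨mul⟩
    let : Zero K := ⟨zero⟩
    let : One K := ⟨one⟩
    let : Neg K := ⟨ng⟩
    let : Inv K := ⟨fun x => if hx : x = zero then zero else Classical.choose (existsInv x hx)⟩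
    let F : Field K := Field.ofMinimalAxioms K addAssoc zeroAdd
      (fun x => (addComm _ _).trans (hng x)) mulAssoc mulComm oneMul
      (fun x hx => by
        change mul x (dite _ _ _) = one
        rw [dif_neg (show ¬ x = zero from hx)]
        exact Classical.choose_spec (existsInv x hx))
      (dif_pos rfl) leftDistrib ⟨zero, one, zeroNeOne⟩
    have sigmaZero : ∀ g, sg g zero = zero := fun g => by
      have h1 : sg g (0 + 0 : K) = sg g 0 + sg g 0 := sigmaAdd g 0 0
      rw [add_zero] at h1
      exact left_eq_add.mp h1
    let A : MulSemiringAction G K :=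
      { smul := sg
        one_smul := sigmaId
        mul_smul := fun g h x => (sigmaComp g h x).symm
        smul_zero := sigmaZero
        smul_add := sigmaAdd
        smul_one := sigmaOne
        smul_mul := sigmaMul }
    refine ⟨F, A, ?_⟩
    have e2 : ∀ x : Fin 2 → K, x = ![x 0, x 1] := fun x => by ext i; fin_cases i <;> rfl
    have e1 : ∀ x : Fin 1 → K, x = ![x 0] := fun x => by ext i; fin_cases i; rfl
    ext n f x
    · match n, f with
      | _, Func.add => exact congrArg (S.funMap _) (e2 x)
      | _, Func.mul => exact congrArg (S.funMap _) (e2 x)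
      | _, Func.zero => exact congrArg (S.funMap _) (Subsingleton.elim _ _)
      | _, Func.one => exact congrArg (S.funMap _) (Subsingleton.elim _ _)
      | _, Func.sigma g => exact congrArg (S.funMap _) (e1 x)
    · exact Empty.elim f
  · rintro ⟨F, A, rfl⟩
    let := toStructure G K
    have fa : ∀ x, FirstOrder.Language.Structure.funMap (M := K) (addF (G := G)) x
        = x 0 + x 1 := fun _ => rfl
    have fm : ∀ x, FirstOrder.Language.Structure.funMap (M := K) (mulF (G := G)) x
        = x 0 * x 1 := fun _ => rfl
    have fs : ∀ (g : G) x, FirstOrder.Language.Structure.funMap (M := K) (sigmaF g) x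
        = g • x 0 := fun _ _ => rfl
    have f0 : ∀ x, FirstOrder.Language.Structure.funMap (M := K) (zeroF (G := G)) x = 0 :=
      fun _ => rfl
    have f1 : ∀ x, FirstOrder.Language.Structure.funMap (M := K) (oneF (G := G)) x = 1 :=
      fun _ => rfl
    refine ⟨?_⟩
    rintro _ ⟨ax, rfl⟩
    cases ax <;>
      simp [FieldAx.toSentence, FirstOrder.Language.Sentence.Realize,
        FirstOrder.Language.Formula.Realize, realize_tAdd, realize_tMul, realize_tZero,
        realize_tOne, realize_tSigma, fa, fm, fs, f0, f1,
        Fin.snoc, add_assoc, mul_assoc, mul_add, smul_mul', mul_smul]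
    case addComm => exact fun x y => add_comm x y
    case existsNeg => exact fun x => ⟨-x, add_neg_cancel x⟩
    case mulComm => exact fun x y => mul_comm x y
    case existsInv => exact fun x hx => ⟨x⁻¹, mul_inv_cancel₀ hx⟩

/-! ### The axiom scheme -/

section Polynomials

variable {G} {K : Type u} [Field K] [MulSemiringAction G K] {n : ℕ}

/-- The action of `g : G` on the polynomial ring `K[X_{h,i} : h ∈ G, 1 ≤ i ≤ n]`:
it acts on the coefficients, and sends the variable `X_{h,i}` to `X_{gh,i}`. -/
noncomputable def polyAct (g : G) :
    MvPolynomial (G × Fin n) K →+* MvPolynomial (G × Fin n) K :=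
  (MvPolynomial.rename (R := K) (fun p : G × Fin n => (g * p.1, p.2))).toRingHom.comp
    (MvPolynomial.map (MulSemiringAction.toRingHom G K g))

/-- `I` is `G`-invariant: `σ_g(I) ⊆ I` for all `g`. -/
def IsInvariant (I : Ideal (MvPolynomial (G × Fin n) K)) : Prop :=
  ∀ (g : G), ∀ f ∈ I, polyAct g f ∈ I

variable (G) in
/-- The point `(σ_g(a))_{g ∈ G}` of `K^{n|G|}`, for `a ∈ K^n`. -/
def sigmaBar (a : Fin n → K) : G × Fin n → K :=
  fun p => p.1 • a p.2

end Polynomials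

/-- The axiom scheme in `n` variables: whenever `I ⊊ J` are ideals of `K[X_{g,i}]` and `I` is a
`G`-invariant prime ideal, there is `a ∈ K^n` with `(σ_g(a))_g ∈ V(I) ∖ V(J)`. -/
def Club (n : ℕ) (K : Type u) [Field K] [MulSemiringAction G K] : Prop :=
  ∀ I J : Ideal (MvPolynomial (G × Fin n) K), I < J → I.IsPrime → IsInvariant I →
    ∃ a : Fin n → K,
      sigmaBar G a ∈ MvPolynomial.zeroLocus K I \ MvPolynomial.zeroLocus K J

/-- A `lang G`-structure is a model of `G`-TCF: it is a `G`-transformal field that satisfies the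
axiom scheme for every `n > 0`. -/
def IsTCF (K : Type u) [S : (lang G).Structure K] : Prop :=
  ∃ (_ : Field K) (_ : MulSemiringAction G K),
    S = toStructure G K ∧ ∀ n : ℕ, 0 < n → Club G n K

end Structures

end GTransformal

universe w

/-! Everything rests on generic points. The difference relations over `K` of a tuple in an extension
of `K` form an invariant prime ideal (`isInvariant_ker_evalBar`), and every invariant prime arises
so, from the fraction field of the quotient (`exists_generic_point`). With `J = ⊤`, (♣) therefore
says that the relations of any finite tuple of an extension are realised in `K`. Gluing the
resulting partial maps embeds the extension over `K` in an ultrapower of `K`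
(`exists_hom_ultrapower`); existential closedness and model completeness follow by Łoś's theorem.

Fields with (♣) are built by Zorn's lemma, from a maximal set of finite systems over `K` solvable in
one extension (`exists_solving_extension`), repeated countably often (`exists_hom_club`).

Axioms for (♣) are not written out: the theory consists of all sentences true in every field with
(♣), and the task is to show that its models have (♣) (`club_of_model`). Such a model `K` is
perfect, so the function field `L` of an invariant prime is that of a hypersurface `P = 0`
(`exists_hypersurface_presentation`). The action of `G` on `L` and the generic point are then given
by finitely many rational functions, and the relations between them are divisibilities by `P`.
Divisibility and irreducibility are first order in the coefficients, so the same formulas yield an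
invariant prime over some field with (♣) sharing the relevant properties of `K`. A solution exists
there, and its existence, being first order, comes back to `K`. -/

namespace GTransformal

open FirstOrder FirstOrder.Language Filter

attribute [local instance] toStructure

/-! ### Equivariant homomorphisms and evaluation at conjugate tuples -/

section Homs

variable {G : Type v} [Group G]
variable {K : Type u} [Field K] [MulSemiringAction G K]
variable {N : Type w} [Field N] [MulSemiringAction G N]

/-- An equivariant homomorphism of `G`-transformal fields is an embedding of structures. -/
def embeddingOfHom (i : K →+*[G] N) : K ↪[lang G] N where
  toFun := i
  inj' := (i : K →+* N).injective
  map_fun' := by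
    intro n f x
    match n, f with
    | _, Func.add => exact map_add i _ _
    | _, Func.mul => exact map_mul i _ _
    | _, Func.zero => exact map_zero i
    | _, Func.one => exact map_one i
    | _, Func.sigma g => exact map_smul i g _
  map_rel' := fun r => Empty.elim r

/-- An embedding of `G`-transformal fields is an equivariant homomorphism. -/
def homOfEmbedding (f : K ↪[lang G] N) : K →+*[G] N where
  toFun := f
  map_smul' g x := f.map_fun (sigmaF g) ![x]
  map_zero' := f.map_fun (zeroF (G := G)) ![]
  map_one' := f.map_fun (oneF (G := G)) ![]
  map_add' x y := f.map_fun (addF (G := G)) ![x, y]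
  map_mul' x y := f.map_fun (mulF (G := G)) ![x, y]

variable (G) in
theorem isTransformalField_toStructure : IsTransformalField G K := ⟨_, _, rfl⟩

variable {n : ℕ}

/-- Evaluation at `(σ_g(b))_g` over an extension. -/
noncomputable def evalBar (i : K →+*[G] N) (b : Fin n → N) : MvPolynomial (G × Fin n) K →+* N :=
  MvPolynomial.eval₂Hom (i : K →+* N) (sigmaBar G b)

theorem evalBar_apply (i : K →+*[G] N) (b : Fin n → N) (q : MvPolynomial (G × Fin n) K) :
    evalBar i b q = MvPolynomial.eval₂ (i : K →+* N) (sigmaBar G b) q := rfl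

@[simp] theorem evalBar_X (i : K →+*[G] N) (b : Fin n → N) (p : G × Fin n) :
    evalBar i b (MvPolynomial.X p) = p.1 • b p.2 := by
  simp [evalBar, sigmaBar]

@[simp] theorem evalBar_C (i : K →+*[G] N) (b : Fin n → N) (k : K) :
    evalBar i b (MvPolynomial.C k) = i k := by
  simp [evalBar]

@[simp] theorem polyAct_X (g : G) (p : G × Fin n) :
    polyAct g (MvPolynomial.X p : MvPolynomial (G × Fin n) K) = MvPolynomial.X (g * p.1, p.2) := by
  simp [polyAct]

@[simp] theorem polyAct_C (g : G) (k : K) :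
    polyAct g (MvPolynomial.C k : MvPolynomial (G × Fin n) K) = MvPolynomial.C (g • k) := by
  simp [polyAct]

theorem evalBar_polyAct (i : K →+*[G] N) (b : Fin n → N) (g : G)
    (q : MvPolynomial (G × Fin n) K) : evalBar i b (polyAct g q) = g • evalBar i b q := by
  have : (evalBar i b).comp (polyAct g) =
      (MulSemiringAction.toRingHom G N g).comp (evalBar i b) := by
    apply MvPolynomial.ringHom_ext
    · intro k; simp
    · intro p; simp [mul_smul]
  exact congrArg (fun φ : MvPolynomial (G × Fin n) K →+* N => φ q) this

theorem evalBar_comp {M : Type*} [Field M] [MulSemiringAction G M] (j : N →+*[G] M)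
    (i : K →+*[G] N) (a : Fin n → N) (q : MvPolynomial (G × Fin n) K) :
    evalBar (j.comp i) (j ∘ a) q = j (evalBar i a q) := by
  have : evalBar (j.comp i) (j ∘ a) = (j : N →+* M).comp (evalBar i a) := by
    apply MvPolynomial.ringHom_ext
    · intro k; simp
    · intro p; simp [map_smul]
  rw [this]; rfl

theorem isInvariant_ker_evalBar (i : K →+*[G] N) (b : Fin n → N) :
    IsInvariant (RingHom.ker (evalBar i b)) := by
  intro g q hq
  rw [RingHom.mem_ker] at hq ⊢
  rw [evalBar_polyAct, hq, smul_zero]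

theorem aeval_sigmaBar (a : Fin n → K) (q : MvPolynomial (G × Fin n) K) :
    MvPolynomial.aeval (sigmaBar G a) q = evalBar (MulSemiringActionHom.id G) a q := rfl

end Homs

/-! ### Ultraproducts of `G`-transformal fields -/

section Ultraproducts

instance piMulSemiringAction {G : Type v} [Group G] {ι : Type w} (K : ι → Type u)
    [∀ i, Field (K i)] [∀ i, MulSemiringAction G (K i)] : MulSemiringAction G (∀ i, K i) where
  smul_one g := funext fun _ => smul_one g
  smul_mul g x y := funext fun i => smul_mul' g (x i) (y i)

variable {G : Type v} [Group G] {ι : Type w} (U : Ultrafilter ι)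
  (K : ι → Type u) [∀ i, Field (K i)] [∀ i, MulSemiringAction G (K i)]

/-- An ultraproduct of `G`-transformal fields is a `G`-transformal field. -/
theorem exists_ultraproduct :
    ∃ (M : Type (max w u)) (_ : Field M) (_ : MulSemiringAction G M) (π : (∀ i, K i) →+*[G] M),
      Function.Surjective π ∧ (∀ x, π x = 0 ↔ ∀ᶠ i in U, x i = 0) ∧
      ∀ (β : Type) (φ : (lang G).Formula β) (x : β → ∀ i, K i),
        φ.Realize (fun b => π (x b)) ↔ ∀ᶠ i in U, φ.Realize (fun b => x b i) := by
  have hM : (U : Filter ι).Product K ⊨ fieldTheory G := by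
    refine ⟨fun φ hφ => ?_⟩
    rw [Ultraproduct.sentence_realize]
    exact Eventually.of_forall fun i =>
      ((model_fieldTheory_iff G (K i)).2 (isTransformalField_toStructure G)).realize_of_mem _ hφ
  obtain ⟨F, A, hS⟩ := (model_fieldTheory_iff G _).1 hM
  let mk : (∀ i, K i) → (U : Filter ι).Product K := fun x => (x : (U : Filter ι).Product K)
  have key : ∀ {n} (f : (lang G).Functions n) (x : Fin n → ∀ i, K i),
      (toStructure G ((U : Filter ι).Product K)).funMap f (fun i => mk (x i)) =
        mk (fun a => Structure.funMap f fun i => x i a) := by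
    intro n f x
    rw [← hS]
    exact Ultraproduct.funMap_cast f x
  let π : (∀ i, K i) →+*[G] (U : Filter ι).Product K :=
    { toFun := mk
      map_smul' := fun g x => (key (sigmaF g) ![x]).symm
      map_zero' := (key (zeroF (G := G)) ![]).symm
      map_one' := (key (oneF (G := G)) ![]).symm
      map_add' := fun x y => (key (addF (G := G)) ![x, y]).symm
      map_mul' := fun x y => (key (mulF (G := G)) ![x, y]).symm }
  refine ⟨_, F, A, π, Quotient.mk_surjective, fun x => ?_, fun β φ x => ?_⟩
  · rw [← map_zero π]
    exact Quotient.eq''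
  · rw [← hS]
    exact Ultraproduct.realize_formula_cast φ x

end Ultraproducts

/-! ### Embedding extensions into ultrapowers -/

section Clubs

variable {G : Type v} [Group G]
variable {K : Type u} [Field K] [MulSemiringAction G K]
variable {N : Type u} [Field N] [MulSemiringAction G N]

/-- The relations of an enumeration of `s` form an invariant prime ideal. A point of `K` in its zero
locus satisfies all of them, in particular those coming from sums, products, conjugates and elements
of `K` inside `s`. -/
theorem exists_partial_section (hK : ∀ n : ℕ, 0 < n → Club G n K) (i : K →+*[G] N)
    (s : Finset N) :
    ∃ h : N → K, (∀ k, i k ∈ s → h (i k) = k) ∧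
      (∀ a ∈ s, ∀ b ∈ s, a + b ∈ s → h (a + b) = h a + h b) ∧
      (∀ a ∈ s, ∀ b ∈ s, a * b ∈ s → h (a * b) = h a * h b) ∧
      (∀ (g : G), ∀ a ∈ s, g • a ∈ s → h (g • a) = g • h a) := by
  classical
  -- The axiom scheme requires at least one variable, hence the separate empty case.
  rcases s.eq_empty_or_nonempty with rfl | hs
  · exact ⟨fun _ => 0, by simp⟩
  let e := s.equivFin
  let b : Fin s.card → N := fun j => e.symm j
  have hprime : (RingHom.ker (evalBar i b)).IsPrime := RingHom.ker_isPrime _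
  obtain ⟨a, ha, -⟩ := hK s.card hs.card_pos _ ⊤ hprime.ne_top.lt_top hprime
    (isInvariant_ker_evalBar i b)
  have key : ∀ q, evalBar i b q = 0 → evalBar (MulSemiringActionHom.id G) a q = 0 :=
    fun q hq => ha q hq
  let h : N → K := fun x => if hx : x ∈ s then a (e ⟨x, hx⟩) else 0
  have hh : ∀ x (hx : x ∈ s), ∃ j, b j = x ∧ h x = a j := fun x hx =>
    ⟨e ⟨x, hx⟩, by simp [b], dif_pos hx⟩
  refine ⟨h, ?_, ?_, ?_, ?_⟩
  · intro k hk
    obtain ⟨j, hj, h1⟩ := hh _ hk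
    have := key (MvPolynomial.X (1, j) - MvPolynomial.C k) (by simp [hj])
    simpa [h1, sub_eq_zero] using this
  · intro x hx y hy hxy
    obtain ⟨j, hj, h1⟩ := hh _ hx
    obtain ⟨l, hl, h2⟩ := hh _ hy
    obtain ⟨m, hm, h3⟩ := hh _ hxy
    have := key (MvPolynomial.X (1, m) - (MvPolynomial.X (1, j) + MvPolynomial.X (1, l)))
      (by simp [hj, hl, hm])
    rw [h1, h2, h3, ← sub_eq_zero]
    simpa using this
  · intro x hx y hy hxy
    obtain ⟨j, hj, h1⟩ := hh _ hx
    obtain ⟨l, hl, h2⟩ := hh _ hy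
    obtain ⟨m, hm, h3⟩ := hh _ hxy
    have := key (MvPolynomial.X (1, m) - (MvPolynomial.X (1, j) * MvPolynomial.X (1, l)))
      (by simp [hj, hl, hm])
    rw [h1, h2, h3, ← sub_eq_zero]
    simpa using this
  · intro g x hx hgx
    obtain ⟨j, hj, h1⟩ := hh _ hx
    obtain ⟨m, hm, h3⟩ := hh _ hgx
    have := key (MvPolynomial.X (1, m) - MvPolynomial.X (g, j)) (by simp [hj, hm])
    rw [h1, h3, ← sub_eq_zero]
    simpa using this

/-- If `K` satisfies the axiom scheme, every extension of `K` embeds over `K` in an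
ultrapower of `K`. -/
theorem exists_hom_ultrapower (hK : ∀ n : ℕ, 0 < n → Club G n K) (i : K →+*[G] N) :
    ∃ (ι : Type u) (U : Ultrafilter ι) (M : Type u) (_ : Field M) (_ : MulSemiringAction G M)
      (π : (ι → K) →+*[G] M) (e : N →+*[G] M), (∀ k, e (i k) = π (Function.const ι k)) ∧
      Function.Surjective π ∧
      ∀ (β : Type) (φ : (lang G).Formula β) (x : β → ι → K),
        φ.Realize (fun b => π (x b)) ↔ ∀ᶠ i in U, φ.Realize (fun b => x b i) := by
  classical
  choose h h1 h2 h3 h4 using exists_partial_section hK i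
  -- Each `x : N` lies in almost all `s`, so the relations that `h s` preserves inside `s` become
  -- identities in the ultrapower.
  let U : Ultrafilter (Finset N) := Ultrafilter.of atTop
  have hU : ∀ x : N, ∀ᶠ s : Finset N in (U : Filter (Finset N)), x ∈ s := fun x =>
    (Ultrafilter.of_le atTop) ((eventually_ge_atTop {x}).mono fun s hs => by simpa using hs)
  obtain ⟨M, F, A, π, hπ, h0, hL⟩ := exists_ultraproduct (G := G) U (fun _ => K)
  have heq : ∀ x y : Finset N → K, (∀ᶠ s in U, x s = y s) → π x = π y := by
    intro x y hxy
    rw [← sub_eq_zero, ← map_sub, h0]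
    exact hxy.mono fun s hs => sub_eq_zero.2 hs
  have hk : ∀ k, π (fun s => h s (i k)) = π (Function.const _ k) := fun k =>
    heq _ _ ((hU (i k)).mono fun s hs => h1 s k hs)
  let e : N →+*[G] M :=
    { toFun := fun x => π fun s => h s x
      map_smul' := fun g x => by
        refine Eq.trans (heq _ (g • fun s => h s x) ?_) (map_smul π g _)
        filter_upwards [hU x, hU (g • x)] with s hs hs'
        exact h4 s g x hs hs'
      map_zero' := by
        have := hk 0
        rw [map_zero] at this
        rw [this]
        exact map_zero π
      map_one' := by
        have := hk 1
        rw [map_one] at this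
        rw [this]
        exact map_one π
      map_add' := fun x y => by
        refine Eq.trans (heq _ ((fun s => h s x) + fun s => h s y) ?_) (map_add π _ _)
        filter_upwards [hU x, hU y, hU (x + y)] with s hs hs' hs''
        exact h2 s x hs y hs' hs''
      map_mul' := fun x y => by
        refine Eq.trans (heq _ ((fun s => h s x) * fun s => h s y) ?_) (map_mul π _ _)
        filter_upwards [hU x, hU y, hU (x * y)] with s hs hs' hs''
        exact h3 s x hs y hs' hs'' }
  exact ⟨_, U, M, F, A, π, e, hk, hπ, hL⟩

end Clubs

/-! ### Existential closedness and model completeness -/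

section ModelCompleteness

variable {G : Type v} [Group G]

/-- If `K` satisfies the axiom scheme, every extension of `K` embeds over `K` in an elementary
extension of `K`, in which no new existential statements over `K` become true. -/
theorem IsTCF.exists_elementary_amalgam {K N : Type u} [(lang G).Structure K]
    [(lang G).Structure N] (hK : IsTCF G K) (hN : IsTransformalField G N) (i : K ↪[lang G] N) :
    ∃ (M : Type u) (_ : (lang G).Structure M) (j : K → M) (e : N ↪[lang G] M),
      (∀ k, e (i k) = j k) ∧
      (∀ (β : Type) (φ : (lang G).Formula β) (x : β → K), φ.Realize (j ∘ x) ↔ φ.Realize x) ∧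
      ∀ (α β : Type) (φ : (lang G).Formula (α ⊕ β)) (x : α → K) (y : β → M),
        φ.Realize (Sum.elim (j ∘ x) y) → ∃ y', φ.Realize (Sum.elim x y') := by
  obtain ⟨F, A, rfl, hC⟩ := hK
  obtain ⟨F', A', rfl⟩ := hN
  obtain ⟨ι, U, M, F'', A'', π, e, he, hπ, hL⟩ := exists_hom_ultrapower hC (homOfEmbedding i)
  refine ⟨M, toStructure G M, fun k => π (Function.const ι k), embeddingOfHom e, he, ?_, ?_⟩
  · intro β φ x
    refine (hL β φ fun b => Function.const ι (x b)).trans ?_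
    exact eventually_const (f := (U : Filter ι)) (p := φ.Realize x)
  · intro α β φ x y hy
    -- The witnesses lift to sequences in `K`; by Łoś the formula holds at almost every index, and
    -- any one such index gives witnesses in `K`.
    choose y' hy' using fun b => hπ (y b)
    have h1 : Sum.elim ((fun k => π (Function.const ι k)) ∘ x) y =
        fun c => π (Sum.elim (fun a => Function.const ι (x a)) y' c) := by
      funext c
      cases c with
      | inl a => rfl
      | inr b => exact (hy' b).symm
    rw [h1, hL] at hy
    obtain ⟨s, hs⟩ := hy.exists
    refine ⟨fun b => y' b s, ?_⟩
    convert hs using 1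
    funext c
    cases c <;> rfl

theorem IsTCF.isTransformalField {K : Type u} [(lang G).Structure K] (hK : IsTCF G K) :
    IsTransformalField G K := by
  obtain ⟨F, A, hS, -⟩ := hK
  exact ⟨F, A, hS⟩

/-- Fields satisfying the axiom scheme are existentially closed. -/
theorem IsTCF.isExistentiallyClosed {K : Type u} [(lang G).Structure K] (hK : IsTCF G K) :
    IsExistentiallyClosed.{u} (fieldTheory G) K := by
  refine ⟨(model_fieldTheory_iff G K).2 hK.isTransformalField, ?_⟩
  intro N _ hN f m k φ hφ c hb
  obtain ⟨b, hb⟩ := hb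
  obtain ⟨M, _, j, e, he, -, hex⟩ :=
    hK.exists_elementary_amalgam ((model_fieldTheory_iff G N).1 hN) f
  refine hex _ _ φ c (e ∘ b) ?_
  have h1 : Sum.elim (j ∘ c) (e ∘ b) = e ∘ Sum.elim (f ∘ c) b := by
    funext x
    cases x with
    | inl a => exact (he _).symm
    | inr a => rfl
  rw [h1]
  have := (hφ.realize_embedding e (v := Sum.elim (f ∘ c) b) (xs := default)).2 hb
  rwa [Subsingleton.elim (e ∘ default) default] at this

/-- A theory whose models are the fields satisfying the axiom scheme is model complete. -/
theorem isModelComplete_of_model_iff {T : (lang G).Theory}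
    (hT : ∀ (K : Type u) [(lang G).Structure K], K ⊨ T ↔ IsTCF G K) : IsModelComplete.{u} T := by
  have key : ∀ {α : Type} {n : ℕ} (φ : (lang G).BoundedFormula α n) (M N : Type u)
      [(lang G).Structure M] [(lang G).Structure N], M ⊨ T → N ⊨ T → ∀ (f : M ↪[lang G] N)
      (v : α → M) (xs : Fin n → M), φ.Realize (f ∘ v) (f ∘ xs) ↔ φ.Realize v xs := by
    intro α n φ
    induction φ with
    | falsum => intros; exact Iff.rfl
    | equal t₁ t₂ =>
      intro M N _ _ _ _ f v xs
      exact (BoundedFormula.IsAtomic.equal t₁ t₂).isQF.realize_embedding f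
    | rel R ts =>
      intro M N _ _ _ _ f v xs
      exact (BoundedFormula.IsAtomic.rel R ts).isQF.realize_embedding f
    | imp φ ψ h1 h2 =>
      intro M N _ _ hM hN f v xs
      simp only [BoundedFormula.realize_imp, h1 M N hM hN, h2 M N hM hN]
    | @all n φ ih =>
      intro K N _ _ hK hN f v xs
      simp only [BoundedFormula.realize_all]
      constructor
      · intro h a
        have := h (f a)
        rw [← Fin.comp_snoc] at this
        exact (ih K N hK hN f _ _).1 this
      · intro h b
        -- The element `b` need not come from `K`. The universal statement passes to `M` because `j`
        -- is elementary, and its instance at `e b` descends along `e : N → M` by the induction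
        -- hypothesis; this needs `M ⊨ T`, again by elementarity.
        obtain ⟨M, _, j, e, he, hel, -⟩ := ((hT K).1 hK).exists_elementary_amalgam
          ((hT N).1 hN).isTransformalField f
        have hM : M ⊨ T := by
          refine ⟨fun ψ hψ => ?_⟩
          have := (hel Empty ψ default).2 (by
            have := hK.realize_of_mem ψ hψ
            rwa [Sentence.Realize, Subsingleton.elim (default : Empty → K) default] at this)
          rwa [Subsingleton.elim (j ∘ default) default] at this
        have h1 : φ.all.toFormula.Realize (j ∘ Sum.elim v xs) :=
          (hel _ _ _).2 ((BoundedFormula.realize_toFormula _ _).2 (by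
            simpa using h))
        rw [BoundedFormula.realize_toFormula, BoundedFormula.realize_all] at h1
        have h2 := h1 (e b)
        refine (ih N M hN hM e _ _).1 ?_
        have e1 : (j ∘ Sum.elim v xs) ∘ Sum.inl = e ∘ f ∘ v := funext fun a => (he _).symm
        have e2 : (j ∘ Sum.elim v xs) ∘ Sum.inr = e ∘ f ∘ xs := funext fun a => (he _).symm
        rw [e1, e2, ← Fin.comp_snoc] at h2
        exact h2
  intro M N _ _ hM hN f n φ x
  have := key φ M N hM hN f x default
  rwa [Subsingleton.elim (f ∘ default) default] at this

end ModelCompleteness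

/-! ### Generic points of invariant primes -/

section GenericPoints

variable {G : Type v} [Group G]

/-- Transport of a field with `G`-action to a smaller universe. -/
theorem exists_equiv_of_small (L : Type w) [Field L] [MulSemiringAction G L] [Small.{u} L] :
    ∃ (L' : Type u) (_ : Field L') (_ : MulSemiringAction G L') (e : L →+*[G] L'),
      Function.Surjective e := by
  let e : L ≃+* Shrink.{u} L := (Shrink.ringEquiv L).symm
  let A : MulSemiringAction G (Shrink.{u} L) :=
    { smul := fun g x => e (g • e.symm x)
      one_smul := fun x => by change e ((1 : G) • e.symm x) = x; simp
      mul_smul := fun g h x => by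
        change e ((g * h) • e.symm x) = e (g • e.symm (e (h • e.symm x)))
        simp [mul_smul]
      smul_zero := fun g => by change e (g • e.symm 0) = 0; simp
      smul_add := fun g x y => by
        change e (g • e.symm (x + y)) = e (g • e.symm x) + e (g • e.symm y); simp
      smul_one := fun g => by change e (g • e.symm 1) = 1; simp
      smul_mul := fun g x y => by
        change e (g • e.symm (x * y)) = e (g • e.symm x) * e (g • e.symm y)
        simp [smul_mul'] }
  refine ⟨Shrink.{u} L, inferInstance, A, { (e : L →+* Shrink.{u} L) with map_smul' := ?_ },
    e.surjective⟩
  intro g x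
  change e (g • x) = e (g • e.symm (e x))
  simp

variable {K : Type u} [Field K] [MulSemiringAction G K] {n : ℕ}

theorem polyAct_one (q : MvPolynomial (G × Fin n) K) : polyAct 1 q = q := by
  have : polyAct (1 : G) = RingHom.id (MvPolynomial (G × Fin n) K) := by
    apply MvPolynomial.ringHom_ext <;> simp
  rw [this]; rfl

theorem polyAct_mul (g h : G) (q : MvPolynomial (G × Fin n) K) :
    polyAct (g * h) q = polyAct g (polyAct h q) := by
  have : polyAct (g * h) = (polyAct g).comp (polyAct h : MvPolynomial (G × Fin n) K →+* _) := by
    apply MvPolynomial.ringHom_ext <;> simp [mul_smul, mul_assoc]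
  rw [this]; rfl

/-- The quotient by an invariant prime ideal is a domain with `G`-action. -/
theorem exists_quotient (I : Ideal (MvPolynomial (G × Fin n) K)) (hI : I.IsPrime)
    (hG : IsInvariant I) :
    ∃ (A : Type (max u v)) (_ : CommRing A) (_ : IsDomain A) (_ : MulSemiringAction G A)
      (π : MvPolynomial (G × Fin n) K →+* A), Function.Surjective π ∧ RingHom.ker π = I ∧
        ∀ g q, π (polyAct g q) = g • π q := by
  let ρ : G → (MvPolynomial (G × Fin n) K ⧸ I) →+* (MvPolynomial (G × Fin n) K ⧸ I) :=
    fun g => Ideal.quotientMap I (polyAct g) (fun q hq => hG g q hq)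
  have hρ : ∀ g q, ρ g (Ideal.Quotient.mk I q) = Ideal.Quotient.mk I (polyAct g q) :=
    fun g q => Ideal.quotientMap_mk
  let A : MulSemiringAction G (MvPolynomial (G × Fin n) K ⧸ I) :=
    { smul := fun g x => ρ g x
      one_smul := fun x => by
        obtain ⟨q, rfl⟩ := Ideal.Quotient.mk_surjective x
        change ρ 1 _ = _
        rw [hρ, polyAct_one]
      mul_smul := fun g h x => by
        obtain ⟨q, rfl⟩ := Ideal.Quotient.mk_surjective x
        change ρ (g * h) _ = ρ g (ρ h _)
        rw [hρ, hρ, hρ, polyAct_mul]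
      smul_zero := fun g => map_zero (ρ g)
      smul_add := fun g => map_add (ρ g)
      smul_one := fun g => map_one (ρ g)
      smul_mul := fun g => map_mul (ρ g) }
  exact ⟨_, inferInstance, Ideal.Quotient.isDomain I, A, Ideal.Quotient.mk I,
    Ideal.Quotient.mk_surjective, Ideal.mk_ker, fun g q => (hρ g q).symm⟩

/-- Every invariant prime ideal has a generic point in an extension. -/
theorem exists_generic_point [Finite G] (I : Ideal (MvPolynomial (G × Fin n) K)) (hI : I.IsPrime)
    (hG : IsInvariant I) :
    ∃ (L : Type u) (_ : Field L) (_ : MulSemiringAction G L) (i : K →+*[G] L) (b : Fin n → L),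
      RingHom.ker (evalBar i b) = I ∧ ∀ l, ∃ r s, l = evalBar i b r / evalBar i b s := by
  obtain ⟨A, _, _, _, π, hπ, hker, hact⟩ := exists_quotient I hI hG
  -- Finiteness of `G` lets the variables be indexed by some `Fin k`, so that the quotient and its
  -- fraction field have copies in the universe of `K`.
  let e0 := Finite.equivFin (G × Fin n)
  have : Small.{u} (MvPolynomial (G × Fin n) K) :=
    small_of_injective (MvPolynomial.renameEquiv K e0).injective
  have : Small.{u} A := small_of_surjective hπ
  have hdiv := IsFractionRing.div_surjective A (K := FractionRing A)
  have : Small.{u} (FractionRing A) :=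
    small_of_surjective (f := fun p : A × A =>
      algebraMap A (FractionRing A) p.1 / algebraMap A (FractionRing A) p.2) fun x => by
        obtain ⟨a, b, -, h⟩ := hdiv x
        exact ⟨(a, b), h⟩
  let act := IsFractionRing.mulSemiringAction G A (FractionRing A)
  have hsm : ∀ (g : G) (a : A),
      g • algebraMap A (FractionRing A) a = algebraMap A (FractionRing A) (g • a) := fun g a =>
    IsFractionRing.ringEquivOfRingEquiv_algebraMap _ _
  obtain ⟨L, F, AL, e, he⟩ := exists_equiv_of_small.{u} (G := G) (FractionRing A)
  let ψ : MvPolynomial (G × Fin n) K →+* L :=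
    ((e : FractionRing A →+* L).comp (algebraMap A (FractionRing A))).comp π
  have hψ : ∀ g q, ψ (polyAct g q) = g • ψ q := by
    intro g q
    change e (algebraMap A _ (π _)) = g • e (algebraMap A _ (π _))
    rw [hact, ← hsm, map_smul]
  let i : K →+*[G] L :=
    { ψ.comp MvPolynomial.C with
      map_smul' := fun g k => by
        change ψ (MvPolynomial.C (g • k)) = g • ψ (MvPolynomial.C k)
        rw [← hψ, polyAct_C] }
  let b : Fin n → L := fun j => ψ (MvPolynomial.X (1, j))
  have hev : evalBar i b = ψ := by
    apply MvPolynomial.ringHom_ext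
    · intro k
      rw [evalBar_C]
      rfl
    · intro p
      rw [evalBar_X, ← hψ, polyAct_X, mul_one]
  refine ⟨L, F, AL, i, b, ?_, fun l => ?_⟩
  · rw [hev, ← hker]
    ext q
    rw [RingHom.mem_ker, RingHom.mem_ker]
    change e (algebraMap A _ (π q)) = 0 ↔ _
    rw [map_eq_zero_iff e (e : FractionRing A →+* L).injective,
      map_eq_zero_iff _ (IsFractionRing.injective A (FractionRing A))]
  · obtain ⟨x, rfl⟩ := he l
    obtain ⟨a, c, -, rfl⟩ := hdiv x
    obtain ⟨r, rfl⟩ := hπ a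
    obtain ⟨s, rfl⟩ := hπ c
    refine ⟨r, s, ?_⟩
    rw [hev]
    exact map_div₀ (e : FractionRing A →+* L) _ _

end GenericPoints

/-! ### Unions of countable chains -/

section Colimit

variable {G : Type v} [Group G]

theorem exists_colimit (K : ℕ → Type u) [∀ n, Field (K n)] [∀ n, MulSemiringAction G (K n)]
    (f : ∀ n, K n →+*[G] K (n + 1)) :
    ∃ (L : Type u) (_ : Field L) (_ : MulSemiringAction G L) (e : ∀ n, K n →+*[G] L),
      (∀ n x, e (n + 1) (f n x) = e n x) ∧ ∀ x, ∃ n y, e n y = x := by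
  let F : ∀ m n : ℕ, m ≤ n → (K m →+*[G] K n) := fun m n h =>
    Nat.leRecOn (C := fun k => K m →+*[G] K k) h (fun {k} φ => (f k).comp φ)
      (MulSemiringActionHom.id G)
  have hself : ∀ m, F m m le_rfl = MulSemiringActionHom.id G := fun m => Nat.leRecOn_self _
  have hsucc : ∀ m n (h : m ≤ n), F m (n + 1) (h.trans n.le_succ) = (f n).comp (F m n h) :=
    fun m n h => Nat.leRecOn_succ h _
  have hcomp : ∀ k m n (h : k ≤ m) (h' : m ≤ n) x, F m n h' (F k m h x) = F k n (h.trans h') x := by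
    intro k m n h h' x
    induction n, h' using Nat.le_induction with
    | base => rw [hself]; rfl
    | succ n h' ih =>
      rw [hsucc m n h', hsucc k n (h.trans h')]
      exact congrArg (f n) ih
  have : DirectedSystem K (F · · ·) :=
    ⟨fun m x => by rw [hself]; rfl, fun _ _ _ h h' x => hcomp _ _ _ h h' x⟩
  let A : MulSemiringAction G (DirectLimit K F) :=
    { (inferInstance : MulAction G (DirectLimit K F)) with
      smul_zero := fun g => by
        rw [DirectLimit.zero_def 0]
        exact (DirectLimit.smul_def 0 _ g).trans (by rw [smul_zero])
      smul_add := fun g => DirectLimit.induction₂ _ fun n x y => by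
        rw [DirectLimit.add_def]
        refine (DirectLimit.smul_def n _ g).trans ?_
        rw [smul_add, ← DirectLimit.add_def]
        exact congrArg₂ _ (DirectLimit.smul_def n x g).symm (DirectLimit.smul_def n y g).symm
      smul_one := fun g => by
        rw [DirectLimit.one_def 0]
        exact (DirectLimit.smul_def 0 _ g).trans (by rw [smul_one])
      smul_mul := fun g => DirectLimit.induction₂ _ fun n x y => by
        rw [DirectLimit.mul_def]
        refine (DirectLimit.smul_def n _ g).trans ?_
        rw [smul_mul', ← DirectLimit.mul_def]
        exact congrArg₂ _ (DirectLimit.smul_def n x g).symm (DirectLimit.smul_def n y g).symm }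
  refine ⟨DirectLimit K F, inferInstance, A, fun n =>
    { toFun := fun x => ⟦⟨n, x⟩⟧
      map_smul' := fun g x => (DirectLimit.smul_def n x g).symm
      map_zero' := (DirectLimit.zero_def n).symm
      map_one' := (DirectLimit.one_def n).symm
      map_add' := fun x y => (DirectLimit.add_def n x y).symm
      map_mul' := fun x y => (DirectLimit.mul_def n x y).symm }, fun n x => ?_, fun x => ?_⟩
  · change (⟦⟨n + 1, f n x⟩⟧ : DirectLimit K F) = ⟦⟨n, x⟩⟧
    rw [DirectLimit.eq_of_le ⟨n, x⟩ (n + 1) n.le_succ, hsucc n n le_rfl, hself]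
    rfl
  · obtain ⟨n, y, rfl⟩ := DirectLimit.exists_eq_mk F x
    exact ⟨n, y, rfl⟩

end Colimit

/-! ### Construction of fields with (♣) -/

section Existence

variable (G : Type v) [Group G] [Finite G]

/-- Polynomials over `K` in the variables `X_{h,i}`, with `G` replaced by an initial segment of `ℕ`
to stay in the universe of `K`. -/
abbrev SmallPoly (K : Type u) [Field K] (n : ℕ) : Type u :=
  MvPolynomial (Fin (Nat.card G) × Fin n) K

variable {G} in
/-- The isomorphism of `SmallPoly` with the polynomial ring in the variables `X_{h,i}`. -/
noncomputable def SmallPoly.equiv (K : Type u) [Field K] (n : ℕ) :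
    SmallPoly G K n ≃ₐ[K] MvPolynomial (G × Fin n) K :=
  MvPolynomial.renameEquiv K ((Finite.equivFin G).symm.prodCongr (Equiv.refl _))

/-- A system of finitely many equations and one inequation over `K`. -/
abbrev Problem (K : Type u) [Field K] : Type u :=
  Σ n : ℕ, Finset (SmallPoly G K n) × SmallPoly G K n

variable {G}
variable {K : Type u} [Field K] [MulSemiringAction G K]
variable {N : Type w} [Field N] [MulSemiringAction G N]

/-- The point `(σ_g(a))_g` solves the given system. -/
def IsSolution (i : K →+*[G] N) (p : Problem G K) (a : Fin p.1 → N) : Prop :=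
  (∀ q ∈ p.2.1, evalBar i a (SmallPoly.equiv K p.1 q) = 0) ∧
    evalBar i a (SmallPoly.equiv K p.1 p.2.2) ≠ 0

theorem IsSolution.comp {M : Type*} [Field M] [MulSemiringAction G M] (j : N →+*[G] M)
    {i : K →+*[G] N} {p : Problem G K} {a : Fin p.1 → N} (h : IsSolution i p a) :
    IsSolution (j.comp i) p (j ∘ a) := by
  refine ⟨fun q hq => ?_, ?_⟩
  · rw [evalBar_comp, h.1 q hq, map_zero]
  · rw [evalBar_comp]
    exact (map_ne_zero (j : N →+* M)).2 h.2

variable (K) in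
/-- A set of systems over `K` that have solutions in a common extension. -/
def JointlySolvable (S : Set (Problem G K)) : Prop :=
  ∃ (N : Type u) (_ : Field N) (_ : MulSemiringAction G N) (i : K →+*[G] N),
    ∀ p ∈ S, ∃ a, IsSolution i p a

/-- An ultraproduct along the chain works: a system in `S₀` is solvable at every member containing
`S₀`, and these are almost all members. -/
theorem JointlySolvable.sUnion {c : Set (Set (Problem G K))} (hc : ∀ S ∈ c, JointlySolvable K S)
    (hchain : IsChain (· ⊆ ·) c) (hne : c.Nonempty) : JointlySolvable K (⋃₀ c) := by
  classical
  have : Nonempty c := hne.to_subtype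
  have : IsDirectedOrder c := ⟨fun S T => by
    rcases hchain.total S.2 T.2 with h | h
    · exact ⟨T, h, le_rfl⟩
    · exact ⟨S, le_rfl, h⟩⟩
  choose N F A i hi using fun S : c => hc S S.2
  let U : Ultrafilter c := Ultrafilter.of atTop
  have hU : ∀ S : c, ∀ᶠ T : c in (U : Filter c), S ≤ T := fun S =>
    Ultrafilter.of_le atTop (eventually_ge_atTop S)
  obtain ⟨M, FM, AM, π, -, h0, -⟩ := exists_ultraproduct (G := G) U N
  let ii : K →+*[G] ∀ S, N S :=
    { toFun := fun k S => i S k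
      map_smul' := fun g k => funext fun S => map_smul (i S) g k
      map_zero' := funext fun S => map_zero (i S)
      map_one' := funext fun S => map_one (i S)
      map_add' := fun x y => funext fun S => map_add (i S) x y
      map_mul' := fun x y => funext fun S => map_mul (i S) x y }
  have hev : ∀ {n : ℕ} (a : ∀ S, Fin n → N S) (q : MvPolynomial (G × Fin n) K),
      evalBar (π.comp ii) (fun j => π fun S => a S j) q = π fun S => evalBar (i S) (a S) q := by
    intro n a q
    have : evalBar (π.comp ii) (fun j => π fun S => a S j) =
        (π : (∀ S, N S) →+* M).comp (RingHom.pi fun S => evalBar (i S) (a S)) := by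
      apply MvPolynomial.ringHom_ext
      · intro k
        rw [evalBar_C]
        refine congrArg π (funext fun S => ?_)
        exact (evalBar_C (i S) (a S) k).symm
      · intro p
        rw [evalBar_X, ← map_smul]
        refine congrArg π (funext fun S => ?_)
        exact (evalBar_X (i S) (a S) p).symm
    rw [this]
    rfl
  refine ⟨M, FM, AM, π.comp ii, ?_⟩
  rintro p ⟨S₀, hS₀, hp⟩
  have : ∀ S : c, ∃ a, (⟨S₀, hS₀⟩ : c) ≤ S → IsSolution (i S) p a := fun S => by
    by_cases h : (⟨S₀, hS₀⟩ : c) ≤ S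
    · obtain ⟨a, ha⟩ := hi S p (h hp)
      exact ⟨a, fun _ => ha⟩
    -- The value at members below `S₀` is immaterial, as the ultrafilter ignores them.
    · exact ⟨0, fun h' => absurd h' h⟩
  choose a ha using this
  refine ⟨fun j => π fun S => a S j, fun q hq => ?_, ?_⟩
  · rw [hev, h0]
    exact (hU ⟨S₀, hS₀⟩).mono fun S hS => (ha S hS).1 q hq
  · rw [hev, Ne, h0]
    intro h
    obtain ⟨S, h1, h2⟩ := (h.and (hU ⟨S₀, hS₀⟩)).exists
    exact (ha S h2).2 h1

/-- Over a suitable extension of `K`, no new systems over `K` become solvable. -/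
theorem exists_solving_extension (K : Type u) [Field K] [MulSemiringAction G K] :
    ∃ (N : Type u) (_ : Field N) (_ : MulSemiringAction G N) (i : K →+*[G] N),
      ∀ (p : Problem G K) (M : Type u) (_ : Field M) (_ : MulSemiringAction G M) (j : N →+*[G] M),
        (∃ a, IsSolution (j.comp i) p a) → ∃ a, IsSolution i p a := by
  -- If `S` is maximal with common extension `N`, a system solvable in an extension of `N` can be
  -- added to `S`, hence already belongs to it and is solvable in `N`.
  obtain ⟨S, hS⟩ := zorn_subset {S | JointlySolvable K S} (fun c hc hchain => by
    rcases c.eq_empty_or_nonempty with rfl | hne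
    · exact ⟨∅, ⟨K, _, _, MulSemiringActionHom.id G, by simp⟩, by simp⟩
    · exact ⟨⋃₀ c, JointlySolvable.sUnion hc hchain hne, fun s hs => Set.subset_sUnion_of_mem hs⟩)
  obtain ⟨N, F, A, i, hi⟩ := hS.prop
  refine ⟨N, F, A, i, fun p M _ _ j hp => hi p ?_⟩
  have : JointlySolvable K (insert p S) := by
    refine ⟨M, _, _, j.comp i, ?_⟩
    rintro q (rfl | hq)
    · exact hp
    · obtain ⟨a, ha⟩ := hi q hq
      exact ⟨_, ha.comp j⟩
  exact hS.le_of_ge this (Set.subset_insert p S) (Set.mem_insert p S)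

/-- A bundled `G`-transformal field. -/
structure GField (G : Type v) [Group G] : Type (max (u + 1) v) where
  carrier : Type u
  [field : Field carrier]
  [action : MulSemiringAction G carrier]

attribute [instance] GField.field GField.action

/-- Every `G`-transformal field embeds in one that satisfies the axiom scheme. -/
theorem exists_hom_club (K : Type u) [Field K] [MulSemiringAction G K] :
    ∃ (L : Type u) (_ : Field L) (_ : MulSemiringAction G L) (_ : K →+*[G] L),
      ∀ n : ℕ, 0 < n → Club G n L := by
  classical
  have step : ∀ K : GField.{u} G, ∃ (N : GField.{u} G) (i : K.carrier →+*[G] N.carrier),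
      ∀ (p : Problem G K.carrier) (M : Type u) (_ : Field M) (_ : MulSemiringAction G M)
        (j : N.carrier →+*[G] M), (∃ a, IsSolution (j.comp i) p a) → ∃ a, IsSolution i p a := by
    intro K
    obtain ⟨N, F, A, i, h⟩ := exists_solving_extension (G := G) K.carrier
    exact ⟨⟨N⟩, i, h⟩
  choose next emb hnext using step
  let E : ℕ → GField.{u} G := fun n => next^[n] ⟨K⟩
  have hE : ∀ n, E (n + 1) = next (E n) := fun n => Function.iterate_succ_apply' next n _
  have hf : ∀ n, ∃ f : (E n).carrier →+*[G] (E (n + 1)).carrier,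
      ∀ (p : Problem G (E n).carrier) (M : Type u) (_ : Field M) (_ : MulSemiringAction G M)
        (j : (E (n + 1)).carrier →+*[G] M),
        (∃ a, IsSolution (j.comp f) p a) → ∃ a, IsSolution f p a := by
    intro n
    rw [hE]
    exact ⟨emb _, hnext _⟩
  choose f hf using hf
  obtain ⟨L, _, _, e, he, hsurj⟩ := exists_colimit (G := G) (fun n => (E n).carrier) f
  refine ⟨L, _, _, e 0, fun n hn I J hIJ hI hG => ?_⟩
  -- By noetherianity it suffices to solve a finite system: generators of `I` vanish and one `r ∈ J
  -- ∖ I` does not. Its finitely many coefficients come from one stage `m`.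
  obtain ⟨r, hrJ, hrI⟩ := SetLike.exists_of_lt hIJ
  obtain ⟨M, _, _, i, b, hker, -⟩ := exists_generic_point I hI hG
  obtain ⟨F, hF⟩ := (isNoetherianRing_iff_ideal_fg _).1
    (inferInstance : IsNoetherianRing (MvPolynomial (G × Fin n) L)) I
  -- all polynomials involved come from a finite stage
  have hmono : Monotone fun m =>
      (MvPolynomial.map (σ := G × Fin n) (e m : (E m).carrier →+* L)).range := by
    refine monotone_nat_of_le_succ fun m => ?_
    rintro _ ⟨q, rfl⟩
    refine ⟨MvPolynomial.map (f m : (E m).carrier →+* (E (m + 1)).carrier) q, ?_⟩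
    rw [MvPolynomial.map_map]
    exact congrArg (fun φ : (E m).carrier →+* L => MvPolynomial.map φ q) (RingHom.ext (he m))
  have hstage : ∀ q : MvPolynomial (G × Fin n) L, ∃ m,
      q ∈ (MvPolynomial.map (σ := G × Fin n) (e m : (E m).carrier →+* L)).range := by
    intro q
    induction q using MvPolynomial.induction_on with
    | C x =>
      obtain ⟨m, y, rfl⟩ := hsurj x
      exact ⟨m, MvPolynomial.C y, by simp⟩
    | add p q hp hq =>
      obtain ⟨m, hm⟩ := hp
      obtain ⟨m', hm'⟩ := hq
      exact ⟨max m m', add_mem (hmono (le_max_left _ _) hm) (hmono (le_max_right _ _) hm')⟩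
    | mul_X p x hp =>
      obtain ⟨m, hm⟩ := hp
      exact ⟨m, mul_mem hm ⟨MvPolynomial.X x, by simp⟩⟩
  choose stage hstage using hstage
  let m := (insert r F).sup stage
  have hm : ∀ q ∈ insert r F, ∃ q' : SmallPoly G (E m).carrier n,
      MvPolynomial.map (e m : (E m).carrier →+* L) (SmallPoly.equiv _ n q') = q := by
    intro q hq
    obtain ⟨q', hq'⟩ := hmono (Finset.le_sup (f := stage) hq) (hstage q)
    exact ⟨(SmallPoly.equiv _ n).symm q', by simpa using hq'⟩
  choose! desc hdesc using hm
  have hev : ∀ {M' : Type u} [Field M'] [MulSemiringAction G M'] (j : L →+*[G] M')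
      (a : Fin n → M') (q : MvPolynomial (G × Fin n) (E m).carrier),
      evalBar (j.comp (e m)) a q =
        evalBar j a (MvPolynomial.map (e m : (E m).carrier →+* L) q) := by
    intro M' _ _ j a q
    simp only [evalBar_apply, MvPolynomial.eval₂_map]
    rfl
  let p : Problem G (E m).carrier := ⟨n, F.image desc, desc r⟩
  have hem : e m = (e (m + 1)).comp (f m) := by
    ext x
    exact (he m x).symm
  have hp : IsSolution (i.comp (e m)) p b := by
    refine ⟨fun q hq => ?_, ?_⟩
    · obtain ⟨q', hq', rfl⟩ := Finset.mem_image.1 hq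
      rw [hev, hdesc q' (Finset.mem_insert_of_mem hq'), ← RingHom.mem_ker, hker, ← hF]
      exact Ideal.subset_span hq'
    · rw [hev, hdesc r (Finset.mem_insert_self _ _), Ne, ← RingHom.mem_ker, hker]
      exact hrI
  -- `M` extends `E (m + 1)` through `L`, so the system, solved by `b` in `M`, has a solution in `E
  -- (m + 1)`.
  obtain ⟨a, ha⟩ := hf m p M _ _ (i.comp (e (m + 1))) ⟨b, by rwa [hem] at hp⟩
  have ha' := ha.comp (e (m + 1))
  rw [← hem] at ha'
  have hev' : ∀ q ∈ insert r F, evalBar (e m) (e (m + 1) ∘ a) (SmallPoly.equiv _ n (desc q)) =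
      MvPolynomial.aeval (sigmaBar G (e (m + 1) ∘ a)) q := by
    intro q hq
    rw [aeval_sigmaBar]
    conv_rhs => rw [← hdesc q hq]
    rw [← hev]
    rfl
  refine ⟨e (m + 1) ∘ a, ?_, fun h => ?_⟩
  · rw [← hF, MvPolynomial.zeroLocus_span]
    intro q hq
    rw [← hev' q (Finset.mem_insert_of_mem hq)]
    exact ha'.1 _ (Finset.mem_image_of_mem _ hq)
  · refine ha'.2 ?_
    exact (hev' r (Finset.mem_insert_self _ _)).trans (h r hrJ)

end Existence

/-! ### Function fields as function fields of hypersurfaces -/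

section Presentation

open MvPolynomial in
/-- A finitely generated extension of a perfect field is generated by the coordinates of the
generic point of a hypersurface. -/
theorem exists_hypersurface_presentation (K : Type u) (L : Type u) [Field K] [Field L]
    [Algebra K L] [PerfectField K] [Algebra.EssFiniteType K L] :
    ∃ (σ : Type u) (_ : Finite σ) (z : σ → L) (P : MvPolynomial σ K), Irreducible P ∧
      (∀ q, aeval z q = 0 ↔ P ∣ q) ∧
      ∀ l, ∃ r s : MvPolynomial σ K, l = aeval z r / aeval z s := by
  obtain ⟨s, hs, hsep⟩ :=
    exists_isTranscendenceBasis_and_isSeparable_of_perfectField (k := K) (K := L)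
  let F := IntermediateField.adjoin K (s : Set L)
  have : Algebra.EssFiniteType F L := Algebra.EssFiniteType.of_comp K F L
  have : Algebra.IsAlgebraic F L := hsep.isAlgebraic
  have : FiniteDimensional F L := by
    obtain ⟨t, ht⟩ := IntermediateField.fg_top F L
    have := IntermediateField.finiteDimensional_adjoin (K := F) (L := L) (S := (t : Set L))
      (fun x _ => (Algebra.IsAlgebraic.isAlgebraic x).isIntegral)
    rw [ht] at this
    exact Module.Finite.equiv (IntermediateField.topEquiv (F := F) (E := L)).toLinearEquiv
  obtain ⟨β, hβ⟩ := Field.exists_primitive_element F L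
  let R := Algebra.adjoin K (Set.range ((↑) : s → L))
  let e : MvPolynomial s K ≃ₐ[K] R := hs.1.aevalEquiv
  have : IsIntegrallyClosed R := IsIntegrallyClosed.of_equiv e.toRingEquiv
  have : Algebra.IsAlgebraic R L := hs.isAlgebraic
  -- Multiplying the primitive element by `c` makes it integral over the polynomial ring `R`. As `R`
  -- is integrally closed, the minimal polynomial over `R` is irreducible and divides every
  -- polynomial over `R` vanishing at `c • β`.
  obtain ⟨c, hc0, hc⟩ := (Algebra.IsAlgebraic.isAlgebraic (R := R) β).exists_integral_multiple
  let z : Option s → L := fun o => o.elim (c • β) (↑)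
  let Φ : MvPolynomial (Option s) K ≃ₐ[K] Polynomial R :=
    (optionEquivLeft K s).trans (Polynomial.mapAlgEquiv e)
  have hΦ : ∀ q, Polynomial.aeval (c • β) (Φ q) = aeval z q := by
    intro q
    have : ((Polynomial.aeval (c • β) : Polynomial R →ₐ[R] L).restrictScalars K).comp
        (Φ : MvPolynomial (Option s) K →ₐ[K] Polynomial R) = aeval z := by
      apply MvPolynomial.algHom_ext
      intro o
      cases o with
      | none => simp [Φ, z, optionEquivLeft_X_none]
      | some x =>
        have h1 : Φ (X (some x)) = Polynomial.C (e (X x)) := by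
          change Polynomial.map _ (optionEquivLeft K s (X (some x))) = _
          rw [optionEquivLeft_X_some, Polynomial.map_C]
          rfl
        change Polynomial.aeval (c • β) (Φ (X (some x))) = _
        rw [h1, Polynomial.aeval_C, aeval_X]
        exact (hs.1.algebraMap_aevalEquiv (X x)).trans (aeval_X _ _)
    exact congrArg (fun φ : MvPolynomial (Option s) K →ₐ[K] L => φ q) this
  refine ⟨Option s, inferInstance, z, Φ.symm (minpoly R (c • β)), ?_, fun q => ?_, fun l => ?_⟩
  · exact (MulEquiv.irreducible_iff Φ.symm.toMulEquiv).2 (minpoly.irreducible hc)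
  · rw [← hΦ, minpoly.isIntegrallyClosed_dvd_iff hc, ← map_dvd_iff Φ, AlgEquiv.apply_symm_apply]
  · rw [← IntermediateField.mem_adjoin_range_iff]
    set E := IntermediateField.adjoin K (Set.range z)
    have hsE : ∀ x ∈ s, x ∈ E := fun x hx =>
      IntermediateField.subset_adjoin K _ ⟨some ⟨x, hx⟩, rfl⟩
    have hcE : (c : L) ∈ E := by
      have : R ≤ E.toSubalgebra := Algebra.adjoin_le (by rintro _ ⟨x, rfl⟩; exact hsE x x.2)
      exact this c.2
    have hβE : β ∈ E := by
      have h1 : (c : L) * β ∈ E := IntermediateField.subset_adjoin K _ ⟨none, rfl⟩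
      have h2 := E.div_mem h1 hcE
      rwa [mul_div_cancel_left₀ _ (by simpa using hc0)] at h2
    have h1 : l ∈ (IntermediateField.adjoin F {β}).restrictScalars K := by
      rw [hβ]; trivial
    rw [IntermediateField.adjoin_adjoin_left] at h1
    refine IntermediateField.adjoin_le_iff.2 ?_ h1
    rintro x (hx | rfl)
    · exact hsE x hx
    · exact hβE

end Presentation

/-! ### First-order definability of polynomial conditions -/

section Definability

/-- A `G`-transformal field with a family of distinguished elements. -/
structure Pointed (G : Type v) [Group G] (α : Type w) extends GField.{u} G where
  pt : α → carrier

variable {G : Type v} [Group G] {α : Type u} {β : Type u}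

/-- Expand a pointed field by further distinguished elements. -/
@[reducible]
def Pointed.extend (p : Pointed.{u} G α) (y : β → p.carrier) : Pointed.{u} G (α ⊕ β) :=
  { p with pt := Sum.elim p.pt y }

/-- A class of pointed fields is definable if it is given by a first-order formula. -/
def IsDef (R : Set (Pointed.{u} G α)) : Prop :=
  ∃ φ : (lang G).Formula α, ∀ p : Pointed.{u} G α, φ.Realize p.pt ↔ p ∈ R

theorem IsDef.compl {R : Set (Pointed.{u} G α)} (h : IsDef R) : IsDef Rᶜ := by
  obtain ⟨φ, hφ⟩ := h
  exact ⟨∼φ, fun p => by rw [Formula.realize_not, hφ]; rfl⟩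

theorem IsDef.inter {R S : Set (Pointed.{u} G α)} (h : IsDef R) (h' : IsDef S) :
    IsDef (R ∩ S) := by
  obtain ⟨φ, hφ⟩ := h
  obtain ⟨ψ, hψ⟩ := h'
  exact ⟨φ ⊓ ψ, fun p => by rw [Formula.realize_inf, hφ, hψ]; rfl⟩

theorem isDef_univ : IsDef (Set.univ : Set (Pointed.{u} G α)) :=
  ⟨⊤, fun p => by simp⟩

theorem IsDef.biInter {κ : Type*} (s : Finset κ) {R : κ → Set (Pointed.{u} G α)}
    (h : ∀ k ∈ s, IsDef (R k)) : IsDef {p | ∀ k ∈ s, p ∈ R k} := by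
  classical
  induction s using Finset.induction_on with
  | empty => simpa using isDef_univ
  | insert k s hk ih =>
    have := (h k (Finset.mem_insert_self _ _)).inter
      (ih fun l hl => h l (Finset.mem_insert_of_mem hl))
    refine (congrArg IsDef ?_).mp this
    ext p
    simp

theorem IsDef.exists [Finite β] {R : Set (Pointed.{u} G (α ⊕ β))} (h : IsDef R) :
    IsDef {p : Pointed.{u} G α | ∃ y : β → p.carrier, p.extend y ∈ R} := by
  obtain ⟨φ, hφ⟩ := h
  refine ⟨φ.iExs β, fun p => ?_⟩
  rw [Formula.realize_iExs]
  exact exists_congr fun y => hφ (p.extend y)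

/-- Difference polynomials with integral coefficients. -/
abbrev DiffPoly (G : Type v) (α : Type u) : Type (max u v) := MvPolynomial (G × α) ℤ

/-- Evaluation of difference polynomials at the distinguished elements. -/
noncomputable def Pointed.ev (p : Pointed.{u} G α) : DiffPoly G α →+* p.carrier :=
  MvPolynomial.eval₂Hom (Int.castRingHom _) fun x => x.1 • p.pt x.2

@[simp] theorem Pointed.ev_X (p : Pointed.{u} G α) (x : G × α) :
    p.ev (MvPolynomial.X x) = x.1 • p.pt x.2 := by
  simp [Pointed.ev]

/-- Difference polynomials in fewer variables. -/
noncomputable def DiffPoly.inl (β : Type u) : DiffPoly G α →+* DiffPoly G (α ⊕ β) :=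
  (MvPolynomial.rename (Prod.map id Sum.inl)).toRingHom

theorem Pointed.extend_ev_inl (p : Pointed.{u} G α) (y : β → p.carrier) (c : DiffPoly G α) :
    (p.extend y).ev (DiffPoly.inl β c) = p.ev c := by
  have : (p.extend y).ev.comp (DiffPoly.inl β) = p.ev := by
    apply MvPolynomial.ringHom_ext
    · intro n; simp
    · intro x; simp [DiffPoly.inl]
  exact congrArg (fun φ : DiffPoly G α →+* p.carrier => φ c) this

/-- The language has no subtraction, so a polynomial is represented by a difference of two terms,
and its vanishing by their equality. -/
theorem exists_term_sub (c : DiffPoly G α) : ∃ s t : (lang G).Term α,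
    ∀ p : Pointed.{u} G α, p.ev c = s.realize p.pt - t.realize p.pt := by
  have rA : ∀ (s t : (lang G).Term α) (p : Pointed.{u} G α),
      (addF.apply₂ s t).realize p.pt = s.realize p.pt + t.realize p.pt :=
    fun s t p => Term.realize_functions_apply₂
  have rM : ∀ (s t : (lang G).Term α) (p : Pointed.{u} G α),
      (mulF.apply₂ s t).realize p.pt = s.realize p.pt * t.realize p.pt :=
    fun s t p => Term.realize_functions_apply₂
  have rS : ∀ (g : G) (t : (lang G).Term α) (p : Pointed.{u} G α),
      ((sigmaF g).apply₁ t).realize p.pt = g • t.realize p.pt :=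
    fun g t p => Term.realize_functions_apply₁
  have rN : ∀ n : ℕ, ∃ t : (lang G).Term α, ∀ p : Pointed.{u} G α, t.realize p.pt = n := by
    intro n
    induction n with
    | zero => exact ⟨.func zeroF ![], fun p => by rw [Nat.cast_zero]; rfl⟩
    | succ n ih =>
      obtain ⟨t, ht⟩ := ih
      exact ⟨addF.apply₂ t (.func oneF ![]), fun p => by rw [rA, ht, Nat.cast_succ]; rfl⟩
  induction c using MvPolynomial.induction_on with
  | C n =>
    obtain ⟨s, hs⟩ := rN n.toNat
    obtain ⟨t, ht⟩ := rN (-n).toNat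
    refine ⟨s, t, fun p => ?_⟩
    have : (n : p.carrier) = (n.toNat : p.carrier) - ((-n).toNat : p.carrier) := by
      exact_mod_cast congrArg (Int.cast : ℤ → p.carrier) (Int.toNat_sub_toNat_neg n).symm
    rw [hs, ht, ← this]
    simp [Pointed.ev]
  | add a b ha hb =>
    obtain ⟨s, t, h⟩ := ha
    obtain ⟨s', t', h'⟩ := hb
    refine ⟨addF.apply₂ s s', addF.apply₂ t t', fun p => ?_⟩
    rw [map_add, h, h', rA, rA]
    ring
  | mul_X a x ha =>
    obtain ⟨s, t, h⟩ := ha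
    refine ⟨mulF.apply₂ s ((sigmaF x.1).apply₁ (.var x.2)),
      mulF.apply₂ t ((sigmaF x.1).apply₁ (.var x.2)), fun p => ?_⟩
    rw [map_mul, h, rM, rM, rS, Pointed.ev_X, Term.realize_var]
    ring

theorem isDef_ev_eq_zero (c : DiffPoly G α) : IsDef {p : Pointed.{u} G α | p.ev c = 0} := by
  obtain ⟨s, t, h⟩ := exists_term_sub c
  refine ⟨s.equal t, fun p => ?_⟩
  rw [Formula.realize_equal, Set.mem_ofPred_eq, h, sub_eq_zero]

variable {σ : Type u}

theorem isDef_map_ev_eq_zero (A : MvPolynomial σ (DiffPoly G α)) :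
    IsDef {p : Pointed.{u} G α | MvPolynomial.map p.ev A = 0} := by
  refine (congrArg IsDef ?_).mp
    (IsDef.biInter A.support fun m _ => isDef_ev_eq_zero (A.coeff m))
  ext p
  simp only [Set.mem_ofPred_eq, MvPolynomial.ext_iff, MvPolynomial.coeff_map,
    MvPolynomial.coeff_zero]
  refine ⟨fun h m => ?_, fun h m _ => h m⟩
  by_cases hm : m ∈ A.support
  · exact h m hm
  · rw [MvPolynomial.notMem_support_iff.1 hm, map_zero]

/-- The polynomial with given coefficients, at monomials from a given finite set. -/
noncomputable def polyOf {R : Type*} [CommSemiring R] (s : Finset (σ →₀ ℕ)) (y : s → R) :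
    MvPolynomial σ R :=
  ∑ m : s, MvPolynomial.monomial m (y m)

theorem map_polyOf {R S : Type*} [CommSemiring R] [CommSemiring S] (φ : R →+* S)
    (s : Finset (σ →₀ ℕ)) (y : s → R) :
    MvPolynomial.map φ (polyOf s y) = polyOf s fun m => φ (y m) := by
  simp [polyOf]

theorem totalDegree_map_le {R S : Type*} [CommSemiring R] [CommSemiring S] (φ : R →+* S)
    (A : MvPolynomial σ R) : (MvPolynomial.map φ A).totalDegree ≤ A.totalDegree :=
  Finset.sup_mono (MvPolynomial.support_map_subset φ A)

/-- The set of monomials does not depend on the field, so quantifying over polynomials of bounded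
degree is quantifying over a fixed finite tuple of coefficients. -/
theorem exists_polyOf [Finite σ] (d : ℕ) : ∃ s : Finset (σ →₀ ℕ),
    ∀ (k : Type u) [Field k] (Q : MvPolynomial σ k), Q.totalDegree ≤ d → ∃ y, Q = polyOf s y := by
  classical
  refine ⟨Finset.Iic (Finsupp.equivFunOnFinite.symm fun _ => d), fun k _ Q hQ =>
    ⟨fun m => Q.coeff m, ?_⟩⟩
  rw [polyOf, Finset.sum_coe_sort _ fun m => MvPolynomial.monomial m (Q.coeff m)]
  conv_lhs => rw [Q.as_sum]
  refine Finset.sum_subset ?_ fun m _ hm => ?_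
  · intro m hm
    rw [Finset.mem_Iic]
    intro j
    refine le_trans ?_ ((MvPolynomial.le_totalDegree hm).trans hQ)
    by_cases hj : j ∈ m.support
    · exact Finset.single_le_sum (f := fun j => m j) (fun _ _ => Nat.zero_le _) hj
    · rw [Finsupp.notMem_support_iff.1 hj]
      exact Nat.zero_le _
  · rw [MvPolynomial.notMem_support_iff.1 hm, map_zero]

/-- Over a domain, the cofactor in a factorisation of a nonzero polynomial has no larger degree.
Specialising coefficients does not raise the degree of `B`, so one bound serves for all `p`. -/
theorem isDef_dvd [Finite σ] (A B : MvPolynomial σ (DiffPoly G α)) :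
    IsDef {p : Pointed.{u} G α | MvPolynomial.map p.ev A ∣ MvPolynomial.map p.ev B} := by
  obtain ⟨s, hs⟩ := exists_polyOf (σ := σ) B.totalDegree
  let i := MvPolynomial.map (σ := σ) (DiffPoly.inl (G := G) (α := α) s)
  let Q : MvPolynomial σ (DiffPoly G (α ⊕ s)) :=
    polyOf s fun m => MvPolynomial.X (1, Sum.inr m)
  refine (congrArg IsDef ?_).mp (isDef_map_ev_eq_zero (i B - i A * Q)).exists
  ext p
  have hi : ∀ y : s → p.carrier, ∀ A, MvPolynomial.map (p.extend y).ev (i A) =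
      MvPolynomial.map p.ev A := by
    intro y A
    rw [MvPolynomial.map_map]
    exact congrArg (fun φ : DiffPoly G α →+* p.carrier => MvPolynomial.map φ A)
      (RingHom.ext fun c => p.extend_ev_inl y c)
  have hQ : ∀ y : s → p.carrier, MvPolynomial.map (p.extend y).ev Q = polyOf s y := by
    intro y
    simp [Q, map_polyOf]
  simp only [Set.mem_ofPred_eq, map_sub, map_mul, hi, hQ, sub_eq_zero]
  constructor
  · rintro ⟨y, hy⟩
    exact ⟨_, hy⟩
  · rintro ⟨q, hq⟩
    -- If `B` specialises to zero, the given cofactor may have any degree and is replaced by zero.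
    by_cases hB : MvPolynomial.map p.ev B = 0
    · exact ⟨0, by simp [hB, polyOf]⟩
    have hA : MvPolynomial.map p.ev A ≠ 0 := by
      rintro h
      rw [h, zero_mul] at hq
      exact hB hq
    have hq0 : q ≠ 0 := by
      rintro rfl
      rw [mul_zero] at hq
      exact hB hq
    obtain ⟨y, hy⟩ := hs p.carrier q (by
      have := MvPolynomial.totalDegree_mul_of_isDomain hA hq0
      rw [← hq] at this
      have h2 := totalDegree_map_le p.ev B
      omega)
    exact ⟨y, by rw [← hy, ← hq]⟩

/-- Factors of a nonzero polynomial have bounded degree, and units are the divisors of `1`. -/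
theorem isDef_irreducible [Finite σ] (A : MvPolynomial σ (DiffPoly G α)) :
    IsDef {p : Pointed.{u} G α | Irreducible (MvPolynomial.map p.ev A)} := by
  obtain ⟨s, hs⟩ := exists_polyOf (σ := σ) A.totalDegree
  let i := MvPolynomial.map (σ := σ) (DiffPoly.inl (G := G) (α := α) (s ⊕ s))
  let Q : MvPolynomial σ (DiffPoly G (α ⊕ (s ⊕ s))) :=
    polyOf s fun m => MvPolynomial.X (1, Sum.inr (Sum.inl m))
  let Q' : MvPolynomial σ (DiffPoly G (α ⊕ (s ⊕ s))) :=
    polyOf s fun m => MvPolynomial.X (1, Sum.inr (Sum.inr m))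
  refine (congrArg IsDef ?_).mp (((isDef_map_ev_eq_zero A).compl.inter (isDef_dvd A 1).compl).inter
    ((isDef_map_ev_eq_zero (i A - Q * Q')).inter
      ((isDef_dvd Q 1).compl.inter (isDef_dvd Q' 1).compl)).exists.compl)
  ext p
  have hi : ∀ y : s ⊕ s → p.carrier, MvPolynomial.map (p.extend y).ev (i A) =
      MvPolynomial.map p.ev A := by
    intro y
    rw [MvPolynomial.map_map]
    exact congrArg (fun φ : DiffPoly G α →+* p.carrier => MvPolynomial.map φ A)
      (RingHom.ext fun c => p.extend_ev_inl y c)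
  have hQ : ∀ y : s ⊕ s → p.carrier,
      MvPolynomial.map (p.extend y).ev Q = polyOf s (y ∘ Sum.inl) := by
    intro y
    simp [Q, map_polyOf, Function.comp_def]
  have hQ' : ∀ y : s ⊕ s → p.carrier,
      MvPolynomial.map (p.extend y).ev Q' = polyOf s (y ∘ Sum.inr) := by
    intro y
    simp [Q', map_polyOf, Function.comp_def]
  simp only [Set.mem_ofPred_eq, Set.mem_inter_iff, Set.mem_compl_iff, map_sub, map_mul, map_one, hi,
    hQ, hQ', sub_eq_zero, ← isUnit_iff_dvd_one]
  constructor
  · rintro ⟨⟨h0, h1⟩, h2⟩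
    refine ⟨h1, fun a b hab => ?_⟩
    by_contra! hu
    have ha : a ≠ 0 := by
      rintro rfl
      exact h0 (by rw [hab, zero_mul])
    have hb : b ≠ 0 := by
      rintro rfl
      exact h0 (by rw [hab, mul_zero])
    have hdeg := MvPolynomial.totalDegree_mul_of_isDomain ha hb
    rw [← hab] at hdeg
    have hle := totalDegree_map_le p.ev A
    obtain ⟨y, rfl⟩ := hs p.carrier a (by omega)
    obtain ⟨y', rfl⟩ := hs p.carrier b (by omega)
    exact h2 ⟨Sum.elim y y', hab, hu⟩
  · intro h
    refine ⟨⟨h.ne_zero, h.not_isUnit⟩, ?_⟩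
    rintro ⟨y, hy, h1, h2⟩
    exact (h.isUnit_or_isUnit hy).elim h1 h2

theorem isDef_solvable {n : ℕ} (F : Finset (MvPolynomial (G × Fin n) (DiffPoly G α)))
    (r : MvPolynomial (G × Fin n) (DiffPoly G α)) :
    IsDef {p : Pointed.{u} G α | ∃ a : Fin n → p.carrier,
      (∀ q ∈ F, MvPolynomial.eval₂ p.ev (sigmaBar G a) q = 0) ∧
        MvPolynomial.eval₂ p.ev (sigmaBar G a) r ≠ 0} := by
  let i : MvPolynomial (G × Fin n) (DiffPoly G α) →+* DiffPoly G (α ⊕ ULift.{u} (Fin n)) :=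
    MvPolynomial.eval₂Hom (DiffPoly.inl _) fun x => MvPolynomial.X (x.1, Sum.inr ⟨x.2⟩)
  have hi : ∀ (p : Pointed.{u} G α) (y : ULift (Fin n) → p.carrier) q, (p.extend y).ev (i q) =
      MvPolynomial.eval₂ p.ev (sigmaBar G fun j => y ⟨j⟩) q := by
    intro p y q
    have : (p.extend y).ev.comp i =
        MvPolynomial.eval₂Hom p.ev (sigmaBar G fun j => y ⟨j⟩) := by
      apply MvPolynomial.ringHom_ext
      · intro c
        simp only [i, RingHom.comp_apply, MvPolynomial.eval₂Hom_C]
        exact p.extend_ev_inl y c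
      · intro x; simp [i, sigmaBar]
    exact congrArg (fun φ : MvPolynomial (G × Fin n) (DiffPoly G α) →+* p.carrier => φ q) this
  refine (congrArg IsDef ?_).mp
    ((IsDef.biInter F fun q _ => isDef_ev_eq_zero (i q)).inter
      (isDef_ev_eq_zero (i r)).compl).exists
  ext p
  simp only [Set.mem_ofPred_eq, Set.mem_inter_iff, Set.mem_compl_iff, hi]
  constructor
  · rintro ⟨y, hy⟩
    exact ⟨fun j => y ⟨j⟩, hy⟩
  · rintro ⟨a, ha⟩
    exact ⟨fun j => a j.down, ha⟩

end Definability

/-! ### Approximating models of the theory by fields with (♣) -/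

section Transfer

variable (G : Type v) [Group G]

/-- The theory of the `G`-transformal fields (in a given universe) that satisfy the axiom
scheme. -/
def tcfTheory : (lang G).Theory :=
  {φ | ∀ (K : Type u) [(lang G).Structure K], IsTCF G K → K ⊨ φ}

variable (K : Type u) [Field K] [MulSemiringAction G K]

/-- The field `K` with all its elements distinguished. -/
@[reducible]
def Pointed.self : Pointed.{u} G K where
  carrier := K
  pt := id

variable {G K}

/-- Otherwise the universal closure of the negated defining formula would hold in all fields with
(♣), hence belong to the theory and hold in `K`. -/
theorem exists_club_mem_of_isDef (hK : K ⊨ tcfTheory.{u} G) {R : Set (Pointed.{u} G K)}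
    (hR : IsDef R) (h : Pointed.self G K ∈ R) :
    ∃ p ∈ R, ∀ n : ℕ, 0 < n → Club G n p.carrier := by
  classical
  obtain ⟨φ, hφ⟩ := hR
  by_contra! hno
  -- Variables are indexed by all of `K`; only the finitely many free ones are kept, so that they
  -- can be quantified.
  let φ' : (lang G).Formula (Empty ⊕ φ.freeVarFinset) :=
    BoundedFormula.restrictFreeVar φ Sum.inr
  have hφ' : ∀ (M : Type u) [(lang G).Structure M] (v : φ.freeVarFinset → M) (v' : K → M),
      (∀ a, v a = v' a) → (φ'.Realize (Sum.elim default v) ↔ φ.Realize v') :=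
    fun M _ v v' hv => BoundedFormula.realize_restrictFreeVar v' hv
  let ψ : (lang G).Sentence :=
    Formula.iAlls (BoundedFormula.freeVarFinset φ) (Formula.not φ')
  have hψ : ψ ∈ tcfTheory.{u} G := by
    intro M _ hM
    obtain ⟨F, A, rfl, hC⟩ := hM
    refine (Formula.realize_iAlls (φ := Formula.not φ')).2 fun v => ?_
    rw [Formula.realize_not]
    intro hv
    let x : K → M := fun k => if hk : k ∈ φ.freeVarFinset then v ⟨k, hk⟩ else 0
    let p : Pointed.{u} G K := { carrier := M, pt := x }
    have hp : p ∈ R := (hφ p).1 ((hφ' M v x fun a => by simp [x]).1 hv)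
    obtain ⟨n, hn, hn'⟩ := hno p hp
    exact hn' (hC n hn)
  have h1 := (Formula.realize_iAlls (φ := Formula.not φ')).1 (hK.realize_of_mem ψ hψ)
    fun a => (a : K)
  rw [Formula.realize_not] at h1
  exact h1 ((hφ' K _ id fun a => rfl).2 ((hφ (Pointed.self G K)).2 h))

variable (G K) in
/-- The filter of the definable classes that contain `K`. -/
def defFilter : Filter (Pointed.{u} G K) where
  sets := {S | ∃ R, IsDef R ∧ Pointed.self G K ∈ R ∧ R ⊆ S}
  univ_sets := ⟨Set.univ, isDef_univ, trivial, le_rfl⟩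
  sets_of_superset := fun ⟨R, h1, h2, h3⟩ h => ⟨R, h1, h2, h3.trans h⟩
  inter_sets := fun ⟨R, h1, h2, h3⟩ ⟨R', h1', h2', h3'⟩ =>
    ⟨R ∩ R', h1.inter h1', ⟨h2, h2'⟩, Set.inter_subset_inter h3 h3'⟩

theorem IsDef.eventually_iff {R : Set (Pointed.{u} G K)} (hR : IsDef R) :
    ∀ᶠ p in defFilter G K, (p ∈ R ↔ Pointed.self G K ∈ R) := by
  by_cases h : Pointed.self G K ∈ R
  · exact ⟨R, hR, h, fun p hp => iff_of_true hp h⟩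
  · exact ⟨Rᶜ, hR.compl, h, fun p hp => iff_of_false hp h⟩

theorem frequently_club (hK : K ⊨ tcfTheory.{u} G) :
    ∃ᶠ p in defFilter G K, ∀ n : ℕ, 0 < n → Club G n p.carrier := by
  rintro ⟨R, hR, h, hsub⟩
  obtain ⟨p, hp, hC⟩ := exists_club_mem_of_isDef hK hR h
  exact hsub hp hC

end Transfer

/-! ### Perfectness -/

section Perfect

variable {G : Type v} [Group G] {K : Type u} [Field K] [MulSemiringAction G K]

/-- Frobenius makes `K` an equivariant extension of itself in which the image of `a` has the `p`-th
root `a`. The relations of this root form an invariant prime containing `X ^ p - a`. -/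
theorem Club.exists_pow_eq (h : Club G 1 K) (p : ℕ) [Fact p.Prime] [CharP K p] (a : K) :
    ∃ b, b ^ p = a := by
  let ev : MvPolynomial (G × Fin 1) K →+* K :=
    MvPolynomial.eval₂Hom (frobenius K p) fun x => x.1 • a
  have hI : (RingHom.ker ev).IsPrime := RingHom.ker_isPrime _
  obtain ⟨b, hb, -⟩ := h (RingHom.ker ev) ⊤ hI.ne_top.lt_top hI (fun g q hq => by
    have : ev.comp (polyAct g) = (MulSemiringAction.toRingHom G K g).comp ev := by
      apply MvPolynomial.ringHom_ext
      · intro k; simp [ev, frobenius_def]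
      · intro x; simp [ev, mul_smul]
    have h2 : ev (polyAct g q) = g • ev q :=
      congrArg (fun φ : MvPolynomial (G × Fin 1) K →+* K => φ q) this
    rw [RingHom.mem_ker] at hq ⊢
    rw [h2, hq, smul_zero])
  refine ⟨b 0, ?_⟩
  have := hb (MvPolynomial.X (1, 0) ^ p - MvPolynomial.C a)
    (by simp [RingHom.mem_ker, ev, frobenius_def])
  simpa [sigmaBar, sub_eq_zero] using this

/-- Having characteristic `p` and a distinguished element without `p`-th root is definable, so it
would occur in a field with (♣). -/
theorem perfectField_of_model (hK : K ⊨ tcfTheory.{u} G) : PerfectField K := by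
  obtain h | ⟨p, hp, hpK⟩ := CharP.exists' K
  · infer_instance
  · suffices PerfectRing K p from PerfectRing.toPerfectField K p
    refine PerfectRing.ofSurjective K p fun a => ?_
    by_contra hno
    have h1 := isDef_ev_eq_zero (G := G) (α := K) (MvPolynomial.C (p : ℤ))
    have h2 := (isDef_ev_eq_zero (G := G) (α := K ⊕ PUnit.{u + 1})
      (MvPolynomial.X (1, Sum.inr ⟨⟩) ^ p - MvPolynomial.X (1, Sum.inl a))).exists
    obtain ⟨q, hq, hC⟩ := exists_club_mem_of_isDef hK (h1.inter h2.compl) (by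
      refine ⟨?_, ?_⟩
      · simp [Pointed.ev]
      · rintro ⟨y, hy⟩
        refine hno ⟨y ⟨⟩, ?_⟩
        simpa [sub_eq_zero, frobenius_def] using hy)
    have hchar : (p : q.carrier) = 0 := by
      have := hq.1
      simpa [Pointed.ev] using this
    have : CharP q.carrier p := (CharP.charP_iff_prime_eq_zero hp.out).2 hchar
    obtain ⟨b, hb⟩ := (hC 1 one_pos).exists_pow_eq p (q.pt a)
    refine hq.2 ⟨fun _ => b, ?_⟩
    simp [hb]

end Perfect

/-! ### Clearing denominators uniformly -/

section Denominators

/-- The numerator `a` and the exponent `k` precede the choice of field, so one numerator decides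
whether `q` vanishes in all fields with `π d ≠ 0`. -/
theorem exists_clear_denominators {B : Type v} [CommRing B] (d : B) {J : Type w} (num : J → B)
    (q : MvPolynomial J B) : ∃ (a : B) (k : ℕ), ∀ (E : Type u) [Field E] (π : B →+* E) (x : J → E),
      (∀ j, π d * x j = π (num j)) → π d ^ k * MvPolynomial.eval₂ π x q = π a := by
  induction q using MvPolynomial.induction_on with
  | C b => exact ⟨b, 0, fun E _ π x _ => by simp⟩
  | add p q hp hq =>
    obtain ⟨a, k, h⟩ := hp
    obtain ⟨a', k', h'⟩ := hq
    refine ⟨a * d ^ k' + a' * d ^ k, k + k', fun E _ π x hx => ?_⟩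
    rw [MvPolynomial.eval₂_add, map_add, map_mul, map_mul, ← h E π x hx, ← h' E π x hx, map_pow,
      map_pow]
    ring
  | mul_X p j hp =>
    obtain ⟨a, k, h⟩ := hp
    refine ⟨a * num j, k + 1, fun E _ π x hx => ?_⟩
    rw [MvPolynomial.eval₂_mul, MvPolynomial.eval₂_X, map_mul, ← h E π x hx, ← hx j]
    ring

theorem exists_common_denominator {B : Type v} [CommRing B] {L : Type u} [Field L] (ψ : B →+* L)
    (hψ : ∀ l, ∃ r s, l = ψ r / ψ s) {J : Type w} [Finite J] (x : J → L) :
    ∃ (d : B) (num : J → B), ψ d ≠ 0 ∧ ∀ j, ψ d * x j = ψ (num j) := by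
  classical
  have := Fintype.ofFinite J
  have : ∀ j, ∃ r s, ψ s ≠ 0 ∧ ψ s * x j = ψ r := by
    intro j
    obtain ⟨r, s, h⟩ := hψ (x j)
    by_cases hs : ψ s = 0
    · exact ⟨0, 1, by simp, by simp [h, hs]⟩
    · exact ⟨r, s, hs, by rw [h, mul_div_cancel₀ _ hs]⟩
  choose r s hs hx using this
  refine ⟨∏ j, s j, fun j => (∏ k ∈ Finset.univ.erase j, s k) * r j, ?_, fun j => ?_⟩
  · rw [map_prod]
    exact Finset.prod_ne_zero_iff.2 fun j _ => hs j
  · rw [map_mul, ← hx, ← mul_assoc, ← map_mul, Finset.prod_erase_mul _ _ (Finset.mem_univ j)]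

/-- The field of rational functions on an irreducible hypersurface. -/
theorem exists_hypersurface_field {k : Type u} [Field k] {σ : Type u} {P : MvPolynomial σ k}
    (hP : Irreducible P) : ∃ (E : Type u) (_ : Field E) (π : MvPolynomial σ k →+* E),
      ∀ q, π q = 0 ↔ P ∣ q := by
  have : (Ideal.span {P}).IsPrime := (Ideal.span_singleton_prime hP.ne_zero).2 hP.prime
  let A := MvPolynomial σ k ⧸ Ideal.span {P}
  refine ⟨FractionRing A, inferInstance,
    (algebraMap A (FractionRing A)).comp (Ideal.Quotient.mk _), fun q => ?_⟩
  rw [RingHom.comp_apply, map_eq_zero_iff _ (IsFractionRing.injective A (FractionRing A)),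
    Ideal.Quotient.eq_zero_iff_mem, Ideal.mem_span_singleton]

end Denominators

/-! ### An invariance criterion for kernels -/

section Invariance

variable {G : Type v} [Group G] {k : Type u} [Field k] [MulSemiringAction G k]

/-- The kernel of evaluation at a point whose coordinates are rational functions on a hypersurface
is invariant if `G` acts on these coordinates through twisted homomorphisms. -/
theorem isInvariant_of_twist {n : ℕ} {σ : Type u} {E : Type u} [Field E]
    (π : MvPolynomial σ k →+* E) (θ : G → MvPolynomial σ k →+* E) (x : G × Fin n → E)
    (d : MvPolynomial σ k) (num : G × Fin n → MvPolynomial σ k)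
    (hx : ∀ j, π d * x j = π (num j))
    (hC : ∀ g c, θ g (MvPolynomial.C c) = π (MvPolynomial.C (g • c)))
    (hker : ∀ g q, π q = 0 → θ g q = 0) (hd : ∀ g, θ g d ≠ 0)
    (hθ : ∀ g (j : G × Fin n), θ g d * x (g * j.1, j.2) = θ g (num j)) :
    IsInvariant (RingHom.ker (MvPolynomial.eval₂Hom (π.comp MvPolynomial.C) x)) := by
  intro g q hq
  rw [RingHom.mem_ker, MvPolynomial.coe_eval₂Hom] at hq ⊢
  -- The same numerator is used for `π` and for `θ g`: vanishing under `π` forces vanishing under `θ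
  -- g`, which gives the conjugate relation up to a nonzero power of `θ g d`.
  obtain ⟨a, m, h⟩ := exists_clear_denominators.{u} d num (MvPolynomial.map MvPolynomial.C q)
  have h1 := h E π x hx
  rw [MvPolynomial.eval₂_map, hq, mul_zero] at h1
  have h2 := h E (θ g) (fun j => x (g * j.1, j.2)) (hθ g)
  rw [hker g a h1.symm, MvPolynomial.eval₂_map] at h2
  have h3 := (mul_eq_zero.1 h2).resolve_left (pow_ne_zero _ (hd g))
  rw [← h3]
  have : (MvPolynomial.eval₂Hom (π.comp MvPolynomial.C) x).comp (polyAct g) =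
      MvPolynomial.eval₂Hom ((θ g).comp MvPolynomial.C) fun j => x (g * j.1, j.2) := by
    apply MvPolynomial.ringHom_ext
    · intro c; simp [hC]
    · intro j; simp
  exact congrArg (fun φ : MvPolynomial (G × Fin n) k →+* E => φ q) this

end Invariance

/-! ### Models of the theory satisfy (♣) -/

section Main

variable {G : Type v} [Group G]

/-- The action of `G` on difference polynomials. -/
noncomputable def DiffPoly.act {α : Type u} (g : G) : DiffPoly G α →+* DiffPoly G α :=
  (MvPolynomial.rename fun x : G × α => (g * x.1, x.2)).toRingHom

theorem Pointed.ev_act {α : Type u} (p : Pointed.{u} G α) (g : G) (c : DiffPoly G α) :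
    p.ev (DiffPoly.act g c) = g • p.ev c := by
  have : p.ev.comp (DiffPoly.act g) = (MulSemiringAction.toRingHom G _ g).comp p.ev := by
    apply MvPolynomial.ringHom_ext
    · intro n; simp
    · intro x; simp [DiffPoly.act, mul_smul]
  exact congrArg (fun φ : DiffPoly G α →+* p.carrier => φ c) this

variable {K : Type u} [Field K] [MulSemiringAction G K]

variable (G K) in
theorem Pointed.self_ev_surjective : Function.Surjective (Pointed.self G K).ev := fun k =>
  ⟨MvPolynomial.X (1, k), (Pointed.ev_X _ _).trans (one_smul G k)⟩

/-- Twisting the coefficients by `g`, and replacing the variables by formal `g`-conjugates. -/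
noncomputable def twist {σ τ : Type*} {α : Type u} (g : G) :
    MvPolynomial σ (DiffPoly G α) →+* MvPolynomial ((G × σ) ⊕ τ) (DiffPoly G α) :=
  MvPolynomial.eval₂Hom (MvPolynomial.C.comp (DiffPoly.act g))
    fun s => MvPolynomial.X (Sum.inl (g, s))

variable {L : Type u} [Field L]

/-- Approximation of rational functions on a hypersurface over `K`: polynomial relations between
them hold eventually for the corresponding rational functions over `p` along `defFilter`. -/
theorem eventually_relation {σ : Type u} [Finite σ] (ψ : MvPolynomial σ K →+* L)
    {P : MvPolynomial σ (DiffPoly G K)} {d : MvPolynomial σ (DiffPoly G K)} {J : Type w}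
    {num : J → MvPolynomial σ (DiffPoly G K)} {x : J → L}
    (hψ : ∀ q, ψ q = 0 ↔ MvPolynomial.map (Pointed.self G K).ev P ∣ q)
    (hd : ψ (MvPolynomial.map (Pointed.self G K).ev d) ≠ 0)
    (hx : ∀ j, ψ (MvPolynomial.map (Pointed.self G K).ev d) * x j =
      ψ (MvPolynomial.map (Pointed.self G K).ev (num j)))
    (q : MvPolynomial J (DiffPoly G K)) :
    ∀ᶠ p in defFilter G K, ∀ (E : Type u) [Field E] (π : MvPolynomial σ p.carrier →+* E)
      (y : J → E), (∀ r, π r = 0 ↔ MvPolynomial.map p.ev P ∣ r) →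
      (∀ j, π (MvPolynomial.map p.ev d) * y j = π (MvPolynomial.map p.ev (num j))) →
      (MvPolynomial.eval₂ ((π.comp MvPolynomial.C).comp p.ev) y q = 0 ↔
        MvPolynomial.eval₂ ((ψ.comp MvPolynomial.C).comp (Pointed.self G K).ev) x q = 0) := by
  -- One numerator `a` serves for every `p`, so vanishing of `q` becomes the definable condition
  -- that `P` divides `a`, provided `P` does not divide `d`.
  obtain ⟨a, m, h⟩ := exists_clear_denominators.{u} d num (MvPolynomial.map MvPolynomial.C q)
  have key : ∀ (p : Pointed.{u} G K) (E : Type u) [Field E] (π : MvPolynomial σ p.carrier →+* E)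
      (y : J → E), (∀ r, π r = 0 ↔ MvPolynomial.map p.ev P ∣ r) →
      π (MvPolynomial.map p.ev d) ≠ 0 →
      (∀ j, π (MvPolynomial.map p.ev d) * y j = π (MvPolynomial.map p.ev (num j))) →
      (MvPolynomial.eval₂ ((π.comp MvPolynomial.C).comp p.ev) y q = 0 ↔
        MvPolynomial.map p.ev P ∣ MvPolynomial.map p.ev a) := by
    intro p E _ π y hπ hd hy
    have h1 := h E (π.comp (MvPolynomial.map p.ev)) y hy
    have h2 : (π.comp (MvPolynomial.map p.ev)).comp MvPolynomial.C =
        (π.comp MvPolynomial.C).comp p.ev := by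
      refine RingHom.ext fun c => ?_
      exact congrArg π (MvPolynomial.map_C p.ev c)
    rw [MvPolynomial.eval₂_map, h2] at h1
    rw [← hπ]
    change _ ↔ (π.comp (MvPolynomial.map p.ev)) a = 0
    rw [← h1, mul_eq_zero]
    exact (or_iff_right (pow_ne_zero m hd)).symm
  filter_upwards [(isDef_dvd P a).eventually_iff, (isDef_dvd P d).eventually_iff] with p h1 h2
  intro E _ π y hπ hy
  have hd' : π (MvPolynomial.map p.ev d) ≠ 0 := by
    rw [Ne, hπ]
    refine mt h2.1 ?_
    rwa [← hψ]
  rw [key p E π y hπ hd' hy, key (Pointed.self G K) L ψ x hψ hd hx]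
  exact h1

/-- This turns statements about the candidate for the `g`-action on a hypersurface field into
polynomial relations between the coordinates `y`. -/
theorem eval₂_twist {α σ : Type u} {τ : Type w} (p : Pointed.{u} G α) {E : Type u} [Field E]
    (κ : p.carrier →+* E) (y : (G × σ) ⊕ τ → E) (g : G) (A : MvPolynomial σ (DiffPoly G α)) :
    MvPolynomial.eval₂ (κ.comp p.ev) y (twist g A) =
      MvPolynomial.eval₂ (κ.comp (MulSemiringAction.toRingHom G _ g)) (fun s => y (Sum.inl (g, s)))
        (MvPolynomial.map p.ev A) := by
  have : (MvPolynomial.eval₂Hom (κ.comp p.ev) y).comp (twist g) =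
      (MvPolynomial.eval₂Hom (κ.comp (MulSemiringAction.toRingHom G _ g))
        fun s => y (Sum.inl (g, s))).comp (MvPolynomial.map p.ev) := by
    apply MvPolynomial.ringHom_ext
    · intro c; simp [twist, Pointed.ev_act]
    · intro s; simp [twist]
  exact congrArg (fun φ : MvPolynomial σ (DiffPoly G α) →+* E => φ A) this

theorem eval₂_rename_inr {α : Type u} {ρ τ : Type*} (p : Pointed.{u} G α) {E : Type u}
    [Field E] (κ : p.carrier →+* E) (y : ρ ⊕ τ → E) (A : MvPolynomial τ (DiffPoly G α)) :
    MvPolynomial.eval₂ (κ.comp p.ev) y (MvPolynomial.rename Sum.inr A) =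
      MvPolynomial.eval₂ κ (y ∘ Sum.inr) (MvPolynomial.map p.ev A) := by
  rw [MvPolynomial.eval₂_rename, MvPolynomial.eval₂_map]

theorem club_of_model [Finite G] (hK : K ⊨ tcfTheory.{u} G) (n : ℕ) (hn : 0 < n) :
    Club G n K := by
  classical
  intro I J hIJ hI hG
  have := perfectField_of_model hK
  obtain ⟨r, hrJ, hrI⟩ := SetLike.exists_of_lt hIJ
  obtain ⟨F, hF⟩ := (isNoetherianRing_iff_ideal_fg _).1
    (inferInstance : IsNoetherianRing (MvPolynomial (G × Fin n) K)) I
  obtain ⟨L, _, _, i, b, hker, hfrac⟩ := exists_generic_point I hI hG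
  let : Algebra K L := (i : K →+* L).toAlgebra
  have hfg : Algebra.EssFiniteType K L := by
    rw [← IntermediateField.fg_top_iff]
    refine ⟨(Set.finite_range (sigmaBar G b)).toFinset, ?_⟩
    rw [Set.Finite.coe_toFinset, eq_top_iff]
    intro l _
    exact (IntermediateField.mem_adjoin_range_iff K _ l).2 (hfrac l)
  obtain ⟨σ, _, z, P₀, hP₀, hz, hzfrac⟩ := exists_hypersurface_presentation K L
  let ψ : MvPolynomial σ K →+* L := (MvPolynomial.aeval z : MvPolynomial σ K →ₐ[K] L)
  -- The conjugates of `z` encode the action on `L`; the other coordinates are the generic point.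
  let x : (G × σ) ⊕ (G × Fin n) → L := Sum.elim (fun j => j.1 • z j.2) (sigmaBar G b)
  let ε := (Pointed.self G K).ev
  have hψC : ψ.comp MvPolynomial.C = (i : K →+* L) :=
    RingHom.ext fun c => MvPolynomial.aeval_C z c
  have hεσ : Function.Surjective (MvPolynomial.map (σ := σ) ε) :=
    MvPolynomial.map_surjective _ (Pointed.self_ev_surjective G K)
  have hεn : Function.Surjective (MvPolynomial.map (σ := G × Fin n) ε) :=
    MvPolynomial.map_surjective _ (Pointed.self_ev_surjective G K)
  obtain ⟨P, rfl⟩ := hεσ P₀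
  obtain ⟨d, num, hd, hx⟩ := exists_common_denominator (ψ.comp (MvPolynomial.map ε)) (fun l => by
    obtain ⟨r, s, h⟩ := hzfrac l
    obtain ⟨r, rfl⟩ := hεσ r
    obtain ⟨s, rfl⟩ := hεσ s
    exact ⟨r, s, h⟩) x
  choose lift hlift using hεn
  have hrel := eventually_relation ψ hz hd hx
  -- the values of the relevant relations over `K`
  have hxtwist : ∀ (g : G) A, MvPolynomial.eval₂ ((ψ.comp MvPolynomial.C).comp ε) x (twist g A) =
      g • ψ (MvPolynomial.map ε A) := by
    intro g A
    rw [eval₂_twist (Pointed.self G K)]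
    have : MvPolynomial.eval₂Hom ((ψ.comp MvPolynomial.C).comp (MulSemiringAction.toRingHom G K g))
        (fun s => x (Sum.inl (g, s))) = (MulSemiringAction.toRingHom G L g).comp ψ := by
      rw [hψC]
      apply MvPolynomial.ringHom_ext
      · intro c
        have h1 : ψ (MvPolynomial.C c) = i c := MvPolynomial.aeval_C z c
        simp [h1, map_smul]
      · intro s
        have h1 : ψ (MvPolynomial.X s) = z s := MvPolynomial.aeval_X z s
        simp [h1, x]
    exact congrArg (fun φ : MvPolynomial σ K →+* L => φ (MvPolynomial.map ε A)) this
  have hxlift : ∀ q, MvPolynomial.eval₂ ((ψ.comp MvPolynomial.C).comp ε) x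
      (MvPolynomial.rename Sum.inr (lift q)) = evalBar i b q := by
    intro q
    rw [eval₂_rename_inr (Pointed.self G K), hψC]
    change MvPolynomial.eval₂ _ _ (MvPolynomial.map ε (lift q)) = _
    rw [hlift]
    rfl
  by_contra hno
  have hS : Pointed.self G K ∉ {p : Pointed.{u} G K | ∃ a : Fin n → p.carrier,
      (∀ q ∈ F.image lift, MvPolynomial.eval₂ p.ev (sigmaBar G a) q = 0) ∧
        MvPolynomial.eval₂ p.ev (sigmaBar G a) (lift r) ≠ 0} := by
    rintro ⟨a, ha, ha'⟩
    have hl : ∀ q, MvPolynomial.eval₂ ε (sigmaBar G a) (lift q) =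
        MvPolynomial.aeval (sigmaBar G a) q := by
      intro q
      conv_rhs => rw [← hlift q]
      rw [MvPolynomial.aeval_def, MvPolynomial.eval₂_map]
      rfl
    refine hno ⟨a, ?_, fun h => ?_⟩
    · rw [← hF, MvPolynomial.zeroLocus_span]
      intro q hq
      exact (hl q).symm.trans (ha _ (Finset.mem_image_of_mem _ hq))
    · exact ha' ((hl r).trans (h r hrJ))
  -- It suffices to refute (♣) for all `p` that agree with `K` on finitely many conditions, one of
  -- them being the absence of a solution.
  refine frequently_club hK ?_
  filter_upwards [(isDef_irreducible P).eventually_iff, (isDef_dvd P d).eventually_iff,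
    (isDef_solvable (F.image lift) (lift r)).eventually_iff,
    eventually_all.2 fun g => hrel (twist g P), eventually_all.2 fun g => hrel (twist g d),
    eventually_all.2 fun g => eventually_all.2 fun j : G × Fin n =>
      hrel (twist g d * MvPolynomial.X (Sum.inr (g * j.1, j.2)) - twist g (num (Sum.inr j))),
    (eventually_all_finset F).2 fun q _ => hrel (MvPolynomial.rename Sum.inr (lift q)),
    hrel (MvPolynomial.rename Sum.inr (lift r))] with p hirr hPd hsol hPg hdg hnum hFp hrp hC
  obtain ⟨E, _, π, hπ⟩ := exists_hypersurface_field (hirr.2 hP₀)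
  have hdp : π (MvPolynomial.map p.ev d) ≠ 0 := by
    rw [Ne, hπ]
    refine mt hPd.1 ?_
    rwa [← hz]
  let y : (G × σ) ⊕ (G × Fin n) → E := fun j =>
    π (MvPolynomial.map p.ev (num j)) / π (MvPolynomial.map p.ev d)
  have hy : ∀ j, π (MvPolynomial.map p.ev d) * y j = π (MvPolynomial.map p.ev (num j)) :=
    fun j => mul_div_cancel₀ _ hdp
  -- The maps `θ g` imitate the action on `L`. No group law is needed for them: killing `P`, not
  -- killing `d` and permuting the coordinates suffice for invariance.
  let θ : G → MvPolynomial σ p.carrier →+* E := fun g =>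
    MvPolynomial.eval₂Hom ((π.comp MvPolynomial.C).comp (MulSemiringAction.toRingHom G _ g))
      fun s => y (Sum.inl (g, s))
  have hθ : ∀ g A, MvPolynomial.eval₂ ((π.comp MvPolynomial.C).comp p.ev) y (twist g A) =
      θ g (MvPolynomial.map p.ev A) := fun g A => eval₂_twist p _ y g A
  have hinv := isInvariant_of_twist π θ (y ∘ Sum.inr) (MvPolynomial.map p.ev d)
    (fun j => MvPolynomial.map p.ev (num (Sum.inr j))) (fun j => hy _)
    (fun g c => by simp [θ])
    (fun g q hq => by
      have h1 : θ g (MvPolynomial.map p.ev P) = 0 := by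
        have h0 : ψ (MvPolynomial.map ε P) = 0 := (hz _).2 dvd_rfl
        rw [← hθ, hPg g E π y hπ hy, hxtwist, h0, smul_zero]
      obtain ⟨q', rfl⟩ := (hπ q).1 hq
      rw [map_mul, h1, zero_mul])
    (fun g => by
      rw [← hθ, Ne, hdg g E π y hπ hy, hxtwist, smul_eq_zero_iff_eq]
      exact hd)
    (fun g j => by
      have h1 := (hnum g j E π y hπ hy).2 (by
        rw [MvPolynomial.eval₂_sub, MvPolynomial.eval₂_mul, hxtwist, hxtwist, MvPolynomial.eval₂_X,
          sub_eq_zero]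
        have h2 : x (Sum.inr (g * j.1, j.2)) = g • x (Sum.inr j) := by
          simp [x, sigmaBar, mul_smul]
        rw [h2, ← smul_mul']
        exact congrArg (g • ·) (hx (Sum.inr j)))
      rw [MvPolynomial.eval₂_sub, MvPolynomial.eval₂_mul, hθ, hθ, MvPolynomial.eval₂_X,
        sub_eq_zero] at h1
      exact h1)
  have hprime : (RingHom.ker (MvPolynomial.eval₂Hom (π.comp MvPolynomial.C)
    (y ∘ (Sum.inr : G × Fin n → _)))).IsPrime := RingHom.ker_isPrime _
  have hrnot : MvPolynomial.map p.ev (lift r) ∉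
      RingHom.ker (MvPolynomial.eval₂Hom (π.comp MvPolynomial.C) (y ∘ Sum.inr)) := by
    rw [RingHom.mem_ker, MvPolynomial.coe_eval₂Hom, ← eval₂_rename_inr, hrp E π y hπ hy, hxlift,
      ← RingHom.mem_ker, hker]
    exact hrI
  -- Enlarging the prime by `r` alone forces `r` not to vanish at the point obtained.
  obtain ⟨a, ha, ha'⟩ := hC n hn _ (_ ⊔ Ideal.span {MvPolynomial.map p.ev (lift r)})
    (left_lt_sup.2 fun h => hrnot (h (Ideal.mem_span_singleton_self _))) hprime hinv
  have hev : ∀ q, MvPolynomial.eval₂ p.ev (sigmaBar G a) q =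
      MvPolynomial.aeval (sigmaBar G a) (MvPolynomial.map p.ev q) := by
    intro q
    rw [MvPolynomial.aeval_def, MvPolynomial.eval₂_map]
    rfl
  refine hS (hsol.1 ⟨a, fun q hq => ?_, fun h => ha' fun q hq => ?_⟩)
  · obtain ⟨q, hqF, rfl⟩ := Finset.mem_image.1 hq
    rw [hev]
    refine ha _ ?_
    rw [RingHom.mem_ker, MvPolynomial.coe_eval₂Hom, ← eval₂_rename_inr, hFp q hqF E π y hπ hy,
      hxlift, ← RingHom.mem_ker, hker, ← hF]
    exact Ideal.subset_span hqF
  · obtain ⟨q₁, h1, q₂, h2, rfl⟩ := Submodule.mem_sup.1 hq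
    obtain ⟨q₃, rfl⟩ := Ideal.mem_span_singleton.1 h2
    rw [map_add, map_mul, ha q₁ h1, ← hev, h, zero_mul, add_zero]

end Main

end GTransformal

open GTransformal in
theorem mainTheorem1 (G : Type v) [Group G] [Finite G] :
    ∃ T : (lang G).Theory,
      (∀ (K : Type u) [(lang G).Structure K], K ⊨ T ↔ IsTCF G K) ∧
      (∀ (K : Type u) [(lang G).Structure K], IsTransformalField G K →
        ∃ (L : Type u) (_ : (lang G).Structure L), IsTCF G L ∧ Nonempty (K ↪[lang G] L)) ∧
      (∀ (K : Type u) [(lang G).Structure K], K ⊨ T →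
        IsExistentiallyClosed.{u} (fieldTheory G) K) ∧
      IsModelComplete.{u} T ∧
      IsModelCompanion.{u} T (fieldTheory G) := by
  have hT : ∀ (K : Type u) [(lang G).Structure K], K ⊨ tcfTheory.{u} G ↔ IsTCF G K := by
    intro K S
    refine ⟨fun hK => ?_, fun hK => ⟨fun φ hφ => hφ K hK⟩⟩
    have hF : K ⊨ fieldTheory G := ⟨fun φ hφ => hK.realize_of_mem φ fun M _ hM =>
      ((model_fieldTheory_iff G M).2 hM.isTransformalField).realize_of_mem φ hφ⟩
    obtain ⟨F, A, rfl⟩ := (model_fieldTheory_iff G K).1 hF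
    exact ⟨F, A, rfl, club_of_model hK⟩
  have hE : ∀ (K : Type u) [(lang G).Structure K], IsTransformalField G K →
      ∃ (L : Type u) (_ : (lang G).Structure L), IsTCF G L ∧ Nonempty (K ↪[lang G] L) := by
    rintro K _ ⟨F, A, rfl⟩
    obtain ⟨L, F', A', i, hL⟩ := exists_hom_club (G := G) K
    exact ⟨L, toStructure G L, ⟨F', A', rfl, hL⟩, ⟨embeddingOfHom i⟩⟩
  have hC := isModelComplete_of_model_iff hT
  refine ⟨tcfTheory.{u} G, hT, hE, fun K _ hK => ((hT K).1 hK).isExistentiallyClosed, hC, hC, ?_, ?_⟩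
  · intro M _ hM
    obtain ⟨L, S, hL, e⟩ := hE M ((model_fieldTheory_iff G M).1 hM)
    exact ⟨L, S, (hT L).2 hL, e⟩
  · intro M _ hM
    exact ⟨M, _, (model_fieldTheory_iff G M).2 ((hT M).1 hM).isTransformalField,
      ⟨FirstOrder.Language.Embedding.refl _ M⟩⟩
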